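/- Let $\mathrm{Homeo}_C(S^1)$ be the set of orientation-preserving homeomorphisms $\gamma$ of the unit circle $S^1$ such that $\gamma$ and $\gamma^{-1}$ are both $C^1$. Let $\varepsilon>0$ and let $\gamma_t$, $t\in(-\varepsilon,\varepsilon)$, be a curve in $\mathrm{Homeo}_C(S^1)$ that is continuously differentiable, i.e. $(t,\theta)\mapsto\gamma_t(e^{i\theta})$ is $C^1$ on $(-\varepsilon,\varepsilon)\times\mathbb R$. (1) For $\gamma\in\mathrm{Homeo}_C(S^1)$ define $t_n=t_n(\gamma)\in\mathbb C$, $n\in\mathbb Z$, by the Fourier expansions on $w=e^{i\theta}$ $$\gamma(w)=\sum_{n\ge1}-n\,t_{-n}w^{-n+1}+t_0w+\sum_{n\ge 1}(-v_{-n})w^{n+1},\qquad \frac1{\gamma^{-1}(w)}=\sum_{n\ge1}n\,t_nw^{n-1}+\sum_{n\ge0}c_nw^{-n-1}.$$ If $\frac{d}{dt}t_n(\gamma_t)=0$ for all $n\in\mathbb Z$ and all $t\in(-\varepsilon,\varepsilon)$, then $\gamma_t=\gamma_0$ for all $t\in(-\varepsilon,\varepsilon)$. Moreover the $t_n$ are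 complete infinitesimally: if at one $t_0\in(-\varepsilon,\varepsilon)$ one has $\frac{d}{dt}\big|_{t=t_0}t_n(\gamma_t)=0$ for all $n\in\mathbb Z$, then $\frac{d}{dt}\big|_{t=t_0}\gamma_t(w)=0$ for all $w\in S^1$. (2) Suppose in addition that for every $t\in(-\varepsilon,\varepsilon)$ the map $\gamma_t=g_t^{-1}\circ f_t|_{S^1}$ is the normalized conformal welding of $\gamma_t$: $f_t,g_t$ are homeomorphisms of $\mathbb C$ which are $C^1$ with $C^1$ inverse, $f_t$ is conformal on $\{|z|<1\}$, $g_t$ is conformal on $\{|z|>1\}$, $f_t(0)=0$, $g_t(\infty)=\infty$ and $f_t'(0)g_t'(\infty)=1$; and that $f_t|_{S^1}$ and $g_t|_{S^1}$ are continuously differentiable families, i.e. $(t,\theta)\mapsto f_t(e^{i\theta})$ and $(t,\theta)\mapsto g_t(e^{i\theta})$ are $C^1$ on $(-\varepsilon,\varepsilon)\times\mathbb R$. Define, for $n\ge1$, $$t_n=\frac1{2\pi i n}\oint_{S^1}\frac{g(w)^{-n}}{f(w)}\,dg(w),\quad t_{-n}=\frac{-1}{2\pi i n}\oint_{S^1}g(w)f(w)^{n-2}\,df(w),\quad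 t_0=\frac1{2\pi i}\oint_{S^1}\frac1{f(w)}\,dg(w)$$ with $f=f_t$, $g=g_t$. Then both conclusions of (1) hold with these $t_n$ in place of those of (1). -/

import Mathlib

/-- The space of orientation preserving `C¹` homeomorphisms of the unit circle: homeomorphisms `γ`
such that `γ` and `γ⁻¹` are both `C¹`, i.e. `θ ↦ γ (e^{iθ})` and `θ ↦ γ⁻¹ (e^{iθ})` are `C¹`.
Writing `γ (e^{iθ}) = e^{iα(θ)}`, the quotient in `orientation` is `α'(θ)`. -/
structure CircleHomeoC where
  toHomeo : Circle ≃ₜ Circle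
  contDiff_toHomeo : ContDiff ℝ 1 (fun θ : ℝ => (toHomeo (Circle.exp θ) : ℂ))
  contDiff_symm : ContDiff ℝ 1 (fun θ : ℝ => (toHomeo.symm (Circle.exp θ) : ℂ))
  orientation : ∀ θ : ℝ,
    0 < (deriv (fun s : ℝ => (toHomeo (Circle.exp s) : ℂ)) θ
          / (Complex.I * (toHomeo (Circle.exp θ) : ℂ))).re

/-- `u t`, `t ∈ (-ε, ε)`, is a continuously differentiable one-parameter family of functions on
the circle: `(t, θ) ↦ u t (e^{iθ})` is `C¹` on `(-ε, ε) × ℝ`. -/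
def IsC1Family (ε : ℝ) (u : ℝ → Circle → ℂ) : Prop :=
  ContDiffOn ℝ 1 (fun p : ℝ × ℝ => u p.1 (Circle.exp p.2)) (Set.Ioo (-ε) ε ×ˢ Set.univ)

/-- The coefficient of `w ^ k` in the Fourier series of a function `φ(w)`, `w = e^{iθ}`. -/
noncomputable def circleFourierCoeff (φ : Circle → ℂ) (k : ℤ) : ℂ :=
  (1 / (2 * (Real.pi : ℂ))) *
    ∫ θ in (0 : ℝ)..(2 * Real.pi), φ (Circle.exp θ) * ((Circle.exp θ : Circle) : ℂ) ^ (-k)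

/-- The variables `t_n` attached to the inverse maps:
`γ(w) = ∑_{n ≥ 1} -n t_{-n} w^{-n+1} + t_0 w + (powers w^{n+1}, n ≥ 1)` and
`1/γ⁻¹(w) = ∑_{n ≥ 1} n t_n w^{n-1} + (negative powers)`. -/
noncomputable def fourierTime (γ : CircleHomeoC) (n : ℤ) : ℂ :=
  if 0 < n then
    (1 / (n : ℂ)) * circleFourierCoeff (fun w => ((γ.toHomeo.symm w : Circle) : ℂ)⁻¹) (n - 1)
  else if n = 0 then
    circleFourierCoeff (fun w => ((γ.toHomeo w : Circle) : ℂ)) 1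
  else
    (1 / (n : ℂ)) * circleFourierCoeff (fun w => ((γ.toHomeo w : Circle) : ℂ)) (n + 1)

/-- `γ = g⁻¹ ∘ f` on the unit circle is the normalized conformal welding of `γ`: `f` and `g` are
`C¹` homeomorphisms of the plane (with `C¹` inverses), `f` is conformal on the open unit disc, `g`
is conformal on the exterior of the closed unit disc, `f(0) = 0`, `g(∞) = ∞`,
`f'(0) g'(∞) = 1`. -/
structure IsConformalWelding (γ : CircleHomeoC) (f g : ℂ ≃ₜ ℂ) : Prop where
  contDiff_f : ContDiff ℝ 1 f
  contDiff_f_symm : ContDiff ℝ 1 f.symm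
  contDiff_g : ContDiff ℝ 1 g
  contDiff_g_symm : ContDiff ℝ 1 g.symm
  holo_f : DifferentiableOn ℂ f {z : ℂ | ‖z‖ < 1}
  holo_g : DifferentiableOn ℂ g {z : ℂ | 1 < ‖z‖}
  f_zero : f 0 = 0
  normalized : ∃ b : ℂ,
    Filter.Tendsto (fun z : ℂ => g z / z) (Bornology.cobounded ℂ) (nhds b) ∧ deriv f 0 * b = 1
  welding : ∀ w : Circle, g.symm (f w) = (γ.toHomeo w : ℂ)

/-- `∮_{S¹} φ(w) dh(w)`, the circle being positively oriented. -/
noncomputable def circleIntegralD (φ h : ℂ → ℂ) : ℂ :=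
  ∫ θ in (0 : ℝ)..(2 * Real.pi),
    φ (Circle.exp θ) * deriv (fun s : ℝ => h (Circle.exp s)) θ

/-- The variables `t_n` attached to the conformal maps themselves: for `n ≥ 1`,
`t_n = 1/(2πin) ∮ g^{-n}/f dg`, `t_{-n} = -1/(2πin) ∮ g f^{n-2} df`, and
`t_0 = 1/(2πi) ∮ (1/f) dg`. -/
noncomputable def weldingTime (f g : ℂ → ℂ) (n : ℤ) : ℂ :=
  if 0 < n then
    (1 / (2 * (Real.pi : ℂ) * Complex.I * n)) *
      circleIntegralD (fun w => g w ^ (-n) / f w) g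
  else if n = 0 then
    (1 / (2 * (Real.pi : ℂ) * Complex.I)) * circleIntegralD (fun w => 1 / f w) g
  else
    (1 / (2 * (Real.pi : ℂ) * Complex.I * n)) *
      circleIntegralD (fun w => g w * f w ^ (-n - 2)) f

open Set Filter Topology MeasureTheory

/-! Write a dot for `d/dt` at `t₀` and a prime for `d/dθ`.

For the Fourier variables, put `p(θ) = e^{-iθ} γ̇(e^{iθ})`. The `t_n` with `n ≤ 0` are modes of `γ`,
and their stationarity says that `p` has only modes `≥ 1`. For `n > 0` the substitution `w =
γ(e^{iθ})` gives `t_n = (2πin)⁻¹ ∮ w⁻¹ γ^{-n} dγ`, whose first variation is proportional to `∫ p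
γ^{-n} dθ`. So the one form `p dθ`, transported by `γ`, has only modes `≤ -1`. A primitive `P` of
`p` then has modes `≥ 0`, while `P ∘ γ⁻¹` has modes `≤ 0`. The energy `Im ∫ conj P dP` is invariant
under reparametrization and is a positive multiple of `∑ n |P̂(n)|²`: it is both `≥ 0` and `≤ 0`, so
`P` is constant and `p = 0` (`eq_zero_of_periodicCoeff_of_comp`).

For the welding variables, put `ω = ġ f' - ḟ g'` and `κ = ω / f²`. Stationarity of the `t_n` says
that `κ` annihilates `f^n` for `n ≥ 0` and `g^{-n}` for `n ≥ 1`. Since polynomials in `f`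
approximate `w^k`, and polynomials in `1/g` without constant term approximate `w^{-k-1}`, all
Fourier modes of `κ` vanish. This is proved by duality, with Cauchy transforms and the
Cauchy–Pompeiu formula (`eq_zero_of_moments`). Hence `ḟ/f' = ġ/g'`. The left side extends
holomorphically to the disc and the right side to the exterior including infinity, so both equal a
constant `c`, and `f'(0) g'(∞) = 1` forces `c = 0` (`variation_eq_zero`). Differentiating `f = g ∘
γ` gives `γ̇ = 0`. -/

/-! ### Fourier coefficients of periodic functions and Parseval's identity -/

theorem continuous_periodicLift {X : Type*} [TopologicalSpace X] {u : ℝ → X} {T : ℝ}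
    (hu : Continuous u) (hp : Function.Periodic u T) : Continuous (hp.lift : AddCircle T → X) :=
  hu.quotient_lift _

theorem coe_circleExp_ne_zero (θ : ℝ) : ((Circle.exp θ : Circle) : ℂ) ≠ 0 := Circle.coe_ne_zero _

theorem circleExp_two_pi_add (θ : ℝ) : Circle.exp (θ + 2 * Real.pi) = Circle.exp θ := by
  rw [Circle.exp_add, Circle.exp_two_pi, mul_one]

theorem coe_circleExp_zpow (θ : ℝ) (n : ℤ) :
    ((Circle.exp θ : Circle) : ℂ) ^ n = ((Circle.exp (n * θ) : Circle) : ℂ) := by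
  rw [Circle.coe_exp, Circle.coe_exp, ← Complex.exp_int_mul]; push_cast; ring_nf

theorem continuous_circleExp_zpow (n : ℤ) :
    Continuous fun θ : ℝ => ((Circle.exp θ : Circle) : ℂ) ^ n := by
  simp_rw [coe_circleExp_zpow]; fun_prop

theorem hasDerivAt_coe_circleExp (θ : ℝ) :
    HasDerivAt (fun s : ℝ => ((Circle.exp s : Circle) : ℂ))
      (Complex.I * ((Circle.exp θ : Circle) : ℂ)) θ := by
  simp_rw [Circle.coe_exp]
  have := ((Complex.ofRealCLM.hasDerivAt (x := θ)).mul_const Complex.I).cexp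
  simpa [mul_comm] using this

theorem hasDerivAt_circleExp_zpow (n : ℤ) (θ : ℝ) :
    HasDerivAt (fun s : ℝ => ((Circle.exp s : Circle) : ℂ) ^ n)
      (Complex.I * n * ((Circle.exp θ : Circle) : ℂ) ^ n) θ := by
  have := (hasDerivAt_zpow n _ (Or.inl (coe_circleExp_ne_zero θ))).comp θ
    (hasDerivAt_coe_circleExp θ)
  refine this.congr_deriv ?_
  rw [zpow_sub_one₀ (coe_circleExp_ne_zero θ)]
  field_simp [coe_circleExp_ne_zero θ]

/-- `∫₀^{2π} u(θ) e^{-inθ} dθ`. -/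
noncomputable def periodicCoeff (u : ℝ → ℂ) (n : ℤ) : ℂ :=
  ∫ θ in (0 : ℝ)..(2 * Real.pi), u θ * ((Circle.exp θ : Circle) : ℂ) ^ (-n)

theorem conj_periodicCoeff (u : ℝ → ℂ) (n : ℤ) :
    (starRingEnd ℂ) (periodicCoeff u n)
      = periodicCoeff (fun θ => (starRingEnd ℂ) (u θ)) (-n) := by
  rw [periodicCoeff, periodicCoeff, intervalIntegral.integral_of_le Real.two_pi_pos.le,
    intervalIntegral.integral_of_le Real.two_pi_pos.le, ← integral_conj]
  congr 1
  ext θ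
  simp only [map_mul, map_zpow₀, neg_neg]
  rw [← Circle.coe_inv_eq_conj, Circle.coe_inv, inv_zpow, zpow_neg, inv_inv]

instance fact_two_pi_pos : Fact (0 < 2 * Real.pi) := ⟨Real.two_pi_pos⟩

theorem fourierCoeff_periodicLift {u : ℝ → ℂ} (hp : Function.Periodic u (2 * Real.pi)) (n : ℤ) :
    fourierCoeff (hp.lift : AddCircle (2 * Real.pi) → ℂ) n
      = (1 / (2 * Real.pi) : ℝ) • periodicCoeff u n := by
  rw [fourierCoeff_eq_intervalIntegral _ _ 0, zero_add, periodicCoeff]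
  congr 1
  refine intervalIntegral.integral_congr fun θ _ => ?_
  simp only [fourier_coe_apply, smul_eq_mul, Function.Periodic.lift_coe]
  rw [mul_comm, Circle.coe_exp, ← Complex.exp_int_mul]
  congr 2
  have : (Real.pi : ℂ) ≠ 0 := by exact_mod_cast Real.pi_ne_zero
  push_cast
  field_simp

/-- Parseval's identity, in bilinear form. -/
theorem hasSum_periodicCoeff_mul {u v : ℝ → ℂ} (hu : Continuous u) (hv : Continuous v)
    (hup : Function.Periodic u (2 * Real.pi)) (hvp : Function.Periodic v (2 * Real.pi)) :
    HasSum (fun n : ℤ => periodicCoeff u (-n) * periodicCoeff v n)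
      (2 * Real.pi * ∫ θ in (0 : ℝ)..(2 * Real.pi), u θ * v θ) := by
  have hcp : Function.Periodic (fun θ => (starRingEnd ℂ) (u θ)) (2 * Real.pi) := fun θ => by
    simp only [hup θ]
  have hc : Continuous fun θ => (starRingEnd ℂ) (u θ) := Complex.continuous_conj.comp hu
  -- The inner product is conjugate linear in its first slot, so `F` carries the conjugate of `u`.
  let F : C(AddCircle (2 * Real.pi), ℂ) := ⟨hcp.lift, continuous_periodicLift hc hcp⟩
  let G : C(AddCircle (2 * Real.pi), ℂ) := ⟨hvp.lift, continuous_periodicLift hv hvp⟩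
  have h := (fourierBasis (T := 2 * Real.pi)).hasSum_inner_mul_inner
    (ContinuousMap.toLp 2 AddCircle.haarAddCircle ℂ F)
    (ContinuousMap.toLp 2 AddCircle.haarAddCircle ℂ G)
  have hG : ∀ n, inner ℂ (fourierBasis n) (ContinuousMap.toLp 2 AddCircle.haarAddCircle ℂ G)
      = (1 / (2 * Real.pi) : ℝ) • periodicCoeff v n := fun n => by
    rw [← HilbertBasis.repr_apply_apply, fourierBasis_repr, fourierCoeff_toLp]
    exact fourierCoeff_periodicLift hvp n
  have hF : ∀ n, inner ℂ (ContinuousMap.toLp 2 AddCircle.haarAddCircle ℂ F) (fourierBasis n)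
      = (1 / (2 * Real.pi) : ℝ) • periodicCoeff u (-n) := fun n => by
    rw [← inner_conj_symm, ← HilbertBasis.repr_apply_apply, fourierBasis_repr, fourierCoeff_toLp]
    have := fourierCoeff_periodicLift hcp n
    change (starRingEnd ℂ) (fourierCoeff hcp.lift n) = _
    rw [this, Complex.real_smul, map_mul, Complex.conj_ofReal, Complex.real_smul,
      conj_periodicCoeff]
    simp only [Complex.conj_conj]
  simp only [hG, hF] at h
  have hI : inner ℂ (ContinuousMap.toLp 2 AddCircle.haarAddCircle ℂ F)
      (ContinuousMap.toLp 2 AddCircle.haarAddCircle ℂ G)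
      = (1 / (2 * Real.pi) : ℝ) • ∫ θ in (0 : ℝ)..(2 * Real.pi), u θ * v θ := by
    rw [ContinuousMap.inner_toLp]
    rw [AddCircle.integral_haarAddCircle, ← AddCircle.intervalIntegral_preimage _ 0, zero_add,
      one_div]
    congr 1
    refine intervalIntegral.integral_congr fun θ _ => ?_
    change hvp.lift (θ : AddCircle (2 * Real.pi))
      * (starRingEnd ℂ) (hcp.lift (θ : AddCircle (2 * Real.pi))) = _
    rw [Function.Periodic.lift_coe, Function.Periodic.lift_coe, Complex.conj_conj, mul_comm]
  rw [hI] at h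
  have h2 := h.mul_left ((2 * Real.pi : ℂ) ^ 2)
  have hpi : (Real.pi : ℂ) ≠ 0 := by exact_mod_cast Real.pi_ne_zero
  have e1 : ∀ x : ℂ, ((2 * Real.pi : ℂ) ^ 2) * ((1 / (2 * Real.pi) : ℝ) • x)
      = 2 * Real.pi * x := fun x => by
    rw [Complex.real_smul]; push_cast; field_simp
  have e2 : ∀ x y : ℂ, ((2 * Real.pi : ℂ) ^ 2) * (((1 / (2 * Real.pi) : ℝ) • x)
      * ((1 / (2 * Real.pi) : ℝ) • y)) = x * y := fun x y => by
    rw [Complex.real_smul, Complex.real_smul]; push_cast; field_simp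
  simpa only [e1, e2] using h2

/-- Every term of Parseval's sum vanishes. This replaces the multiplication of one-sided Fourier
series, for functions that are merely continuous. -/
theorem integral_mul_eq_zero_of_periodicCoeff {u v : ℝ → ℂ} (hu : Continuous u)
    (hv : Continuous v) (hup : Function.Periodic u (2 * Real.pi))
    (hvp : Function.Periodic v (2 * Real.pi))
    (h : ∀ n, periodicCoeff u (-n) = 0 ∨ periodicCoeff v n = 0) :
    ∫ θ in (0 : ℝ)..(2 * Real.pi), u θ * v θ = 0 := by
  have h1 := hasSum_periodicCoeff_mul hu hv hup hvp
  have h2 : (fun n : ℤ => periodicCoeff u (-n) * periodicCoeff v n) = fun _ => 0 := by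
    ext n; rcases h n with h | h <;> simp [h]
  rw [h2] at h1
  have := h1.unique hasSum_zero
  simpa [Real.pi_ne_zero] using this

theorem periodicCoeff_zpow_mul (u : ℝ → ℂ) (k n : ℤ) :
    periodicCoeff (fun θ => ((Circle.exp θ : Circle) : ℂ) ^ k * u θ) n = periodicCoeff u (n - k) := by
  refine intervalIntegral.integral_congr fun θ _ => ?_
  have := coe_circleExp_ne_zero θ
  simp only
  rw [neg_sub, sub_eq_add_neg, zpow_add₀ this]; ring

theorem eq_zero_of_integral_normSq {u : ℝ → ℂ} (hu : Continuous u)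
    (hup : Function.Periodic u (2 * Real.pi))
    (h : ∫ θ in (0 : ℝ)..(2 * Real.pi), u θ * (starRingEnd ℂ) (u θ) = 0) : u = 0 := by
  have h1 : ∫ θ in (0 : ℝ)..(2 * Real.pi), Complex.normSq (u θ) = 0 := by
    have : (fun θ => u θ * (starRingEnd ℂ) (u θ)) = fun θ => ((Complex.normSq (u θ) : ℝ) : ℂ) := by
      ext θ; rw [Complex.mul_conj]
    rw [this, intervalIntegral.integral_ofReal] at h
    exact_mod_cast h
  have hc : Continuous fun θ => Complex.normSq (u θ) := Complex.continuous_normSq.comp hu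
  have h0 : ∀ θ ∈ Icc (0 : ℝ) (2 * Real.pi), u θ = 0 := by
    intro θ hθ
    by_contra hne
    have := intervalIntegral.integral_pos Real.two_pi_pos hc.continuousOn
      (fun x _ => Complex.normSq_nonneg _) ⟨θ, hθ, Complex.normSq_pos.2 hne⟩
    exact this.ne' h1
  ext θ
  obtain ⟨y, hy, hyθ⟩ := hup.exists_mem_Ico₀ Real.two_pi_pos θ
  rw [hyθ, h0 y ⟨hy.1, hy.2.le⟩, Pi.zero_apply]

theorem eq_zero_of_periodicCoeff_eq_zero {u : ℝ → ℂ} (hu : Continuous u)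
    (hup : Function.Periodic u (2 * Real.pi)) (h : ∀ n, periodicCoeff u n = 0) : u = 0 := by
  refine eq_zero_of_integral_normSq hu hup ?_
  exact integral_mul_eq_zero_of_periodicCoeff hu (Complex.continuous_conj.comp hu) hup
    (fun θ => by simp only [hup θ]) fun n => Or.inl (h _)

/-! ### Differentiation of integrals of `C¹` families -/

/-- `(t, θ) ↦ A t θ` is `C¹` on the strip `(-ε, ε) × ℝ`. -/
def IsC1Strip (ε : ℝ) (A : ℝ → ℝ → ℂ) : Prop :=
  ContDiffOn ℝ 1 (fun p : ℝ × ℝ => A p.1 p.2) (Ioo (-ε) ε ×ˢ univ)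

namespace IsC1Strip

variable {ε : ℝ} {A B : ℝ → ℝ → ℂ}

theorem isOpen_strip (ε : ℝ) : IsOpen (Ioo (-ε) ε ×ˢ (univ : Set ℝ)) := isOpen_Ioo.prod isOpen_univ

theorem differentiableAt (hA : IsC1Strip ε A) {t : ℝ} (ht : t ∈ Ioo (-ε) ε) (θ : ℝ) :
    DifferentiableAt ℝ (fun p : ℝ × ℝ => A p.1 p.2) (t, θ) :=
  (hA.differentiableOn one_ne_zero).differentiableAt
    ((isOpen_strip ε).mem_nhds ⟨ht, mem_univ _⟩)

theorem hasDerivAt_fst' (hA : IsC1Strip ε A) {t : ℝ} (ht : t ∈ Ioo (-ε) ε) (θ : ℝ) :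
    HasDerivAt (fun s => A s θ) (fderiv ℝ (fun p : ℝ × ℝ => A p.1 p.2) (t, θ) (1, 0)) t :=
  (hA.differentiableAt ht θ).hasFDerivAt.comp_hasDerivAt (f := fun s : ℝ => (s, θ)) t
    ((hasDerivAt_id t).prodMk (hasDerivAt_const t θ))

theorem hasDerivAt_snd' (hA : IsC1Strip ε A) {t : ℝ} (ht : t ∈ Ioo (-ε) ε) (θ : ℝ) :
    HasDerivAt (A t) (fderiv ℝ (fun p : ℝ × ℝ => A p.1 p.2) (t, θ) (0, 1)) θ :=
  (hA.differentiableAt ht θ).hasFDerivAt.comp_hasDerivAt (f := fun s : ℝ => (t, s)) θ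
    ((hasDerivAt_const θ t).prodMk (hasDerivAt_id θ))

theorem hasDerivAt_fst (hA : IsC1Strip ε A) {t : ℝ} (ht : t ∈ Ioo (-ε) ε) (θ : ℝ) :
    HasDerivAt (fun s => A s θ) (deriv (fun s => A s θ) t) t :=
  (hA.hasDerivAt_fst' ht θ).differentiableAt.hasDerivAt

theorem hasDerivAt_snd (hA : IsC1Strip ε A) {t : ℝ} (ht : t ∈ Ioo (-ε) ε) (θ : ℝ) :
    HasDerivAt (A t) (deriv (A t) θ) θ :=
  (hA.hasDerivAt_snd' ht θ).differentiableAt.hasDerivAt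

theorem continuousOn_deriv_fst (hA : IsC1Strip ε A) :
    ContinuousOn (fun p : ℝ × ℝ => deriv (fun s => A s p.2) p.1) (Ioo (-ε) ε ×ˢ univ) := by
  have h := (hA.continuousOn_fderiv_of_isOpen (isOpen_strip ε) le_rfl).clm_apply
    (continuousOn_const (c := ((1, 0) : ℝ × ℝ)))
  exact h.congr fun p hp => (hA.hasDerivAt_fst' hp.1 p.2).deriv

theorem continuousOn_deriv_snd (hA : IsC1Strip ε A) :
    ContinuousOn (fun p : ℝ × ℝ => deriv (A p.1) p.2) (Ioo (-ε) ε ×ˢ univ) := by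
  have h := (hA.continuousOn_fderiv_of_isOpen (isOpen_strip ε) le_rfl).clm_apply
    (continuousOn_const (c := ((0, 1) : ℝ × ℝ)))
  exact h.congr fun p hp => (hA.hasDerivAt_snd' hp.1 p.2).deriv

theorem continuous_slice {g : ℝ × ℝ → ℂ} (hg : ContinuousOn g (Ioo (-ε) ε ×ˢ univ))
    {t : ℝ} (ht : t ∈ Ioo (-ε) ε) : Continuous fun θ => g (t, θ) :=
  hg.comp_continuous (by fun_prop) fun θ => ⟨ht, mem_univ θ⟩

theorem continuous_snd (hA : IsC1Strip ε A) {t : ℝ} (ht : t ∈ Ioo (-ε) ε) : Continuous (A t) :=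
  continuous_slice hA.continuousOn ht

theorem continuous_deriv_fst (hA : IsC1Strip ε A) {t : ℝ} (ht : t ∈ Ioo (-ε) ε) :
    Continuous fun θ => deriv (fun s => A s θ) t :=
  continuous_slice hA.continuousOn_deriv_fst ht

theorem continuous_deriv_snd (hA : IsC1Strip ε A) {t : ℝ} (ht : t ∈ Ioo (-ε) ε) :
    Continuous (deriv (A t)) :=
  continuous_slice hA.continuousOn_deriv_snd ht

theorem exists_bound {g : ℝ × ℝ → ℂ} (hg : ContinuousOn g (Ioo (-ε) ε ×ˢ univ))
    {t₀ : ℝ} (ht : t₀ ∈ Ioo (-ε) ε) (a b : ℝ) :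
    ∃ M : ℝ, ∃ δ > 0, Metric.closedBall t₀ δ ⊆ Ioo (-ε) ε ∧
      ∀ t ∈ Metric.closedBall t₀ δ, ∀ θ ∈ Icc a b, ‖g (t, θ)‖ ≤ M := by
  obtain ⟨δ, hδ, hsub⟩ := Metric.nhds_basis_closedBall.mem_iff.1 (isOpen_Ioo.mem_nhds ht)
  obtain ⟨M, hM⟩ := ((isCompact_closedBall t₀ δ).prod (isCompact_Icc (a := a) (b := b))).exists_bound_of_continuousOn
    (hg.mono (prod_mono hsub (subset_univ _)))
  exact ⟨M, δ, hδ, hsub, fun t htt θ hθ => hM (t, θ) ⟨htt, hθ⟩⟩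

theorem hasDerivAt_integral_mul (hA : IsC1Strip ε A) {m : ℝ → ℂ} (hm : Continuous m)
    {t₀ : ℝ} (ht : t₀ ∈ Ioo (-ε) ε) {a b : ℝ} (hab : a ≤ b) :
    HasDerivAt (fun t => ∫ θ in a..b, A t θ * m θ)
      (∫ θ in a..b, deriv (fun s => A s θ) t₀ * m θ) t₀ := by
  obtain ⟨M, δ, hδ, hsub, hM⟩ := exists_bound hA.continuousOn_deriv_fst ht a b
  have hI : uIoc a b ⊆ Icc a b := by rw [uIoc_of_le hab]; exact Ioc_subset_Icc_self
  refine (intervalIntegral.hasDerivAt_integral_of_dominated_loc_of_deriv_le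
    (F := fun t θ => A t θ * m θ) (F' := fun t θ => deriv (fun s => A s θ) t * m θ)
    (bound := fun θ => M * ‖m θ‖)
    (Metric.closedBall_mem_nhds t₀ hδ) ?_ ?_ ?_ ?_ ?_ ?_).2
  · filter_upwards [isOpen_Ioo.mem_nhds ht] with t htt
    exact ((hA.continuous_snd htt).mul hm).aestronglyMeasurable
  · exact ((hA.continuous_snd ht).mul hm).intervalIntegrable _ _
  · exact ((hA.continuous_deriv_fst ht).mul hm).aestronglyMeasurable
  · refine ae_of_all _ fun θ hθ t htt => ?_
    rw [norm_mul]
    exact mul_le_mul_of_nonneg_right (hM t htt θ (hI hθ)) (norm_nonneg _)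
  · exact (continuous_const.mul hm.norm).intervalIntegrable _ _
  · exact ae_of_all _ fun θ _ t htt => (hA.hasDerivAt_fst (hsub htt) θ).mul_const _

/-- The factor `A t - A t₀` vanishes at `t₀`, so the difference quotient falls on it alone and `∂_θ
B` need only be continuous in `t`. The mean value inequality provides the dominating constant. -/
theorem hasDerivAt_integral_sub_mul_deriv (hA : IsC1Strip ε A) (hB : IsC1Strip ε B)
    {t₀ : ℝ} (ht : t₀ ∈ Ioo (-ε) ε) {a b : ℝ} (hab : a ≤ b) :
    HasDerivAt (fun t => ∫ θ in a..b, (A t θ - A t₀ θ) * deriv (B t) θ)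
      (∫ θ in a..b, deriv (fun s => A s θ) t₀ * deriv (B t₀) θ) t₀ := by
  obtain ⟨M, δ, hδ, hsub, hM⟩ := exists_bound hA.continuousOn_deriv_fst ht a b
  obtain ⟨M', δ', hδ', hsub', hM'⟩ := exists_bound hB.continuousOn_deriv_snd ht a b
  have hI : uIoc a b ⊆ Icc a b := by rw [uIoc_of_le hab]; exact Ioc_subset_Icc_self
  rw [hasDerivAt_iff_tendsto_slope]
  have hs : slope (fun t => ∫ θ in a..b, (A t θ - A t₀ θ) * deriv (B t) θ) t₀
      = fun t => ∫ θ in a..b, slope (fun s => A s θ) t₀ t * deriv (B t) θ := by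
    ext t
    simp only [slope_def_module, sub_self, zero_mul, intervalIntegral.integral_zero, sub_zero]
    rw [← intervalIntegral.integral_smul]
    simp only [smul_mul_assoc]
  rw [hs]
  have hnear : ∀ᶠ t in 𝓝[≠] t₀, t ∈ Metric.closedBall t₀ δ ∧ t ∈ Metric.closedBall t₀ δ' :=
    mem_nhdsWithin_of_mem_nhds
      (inter_mem (Metric.closedBall_mem_nhds t₀ hδ) (Metric.closedBall_mem_nhds t₀ hδ'))
  refine intervalIntegral.tendsto_integral_filter_of_dominated_convergence
    (fun _ => |M| * |M'|) ?_ ?_ intervalIntegrable_const ?_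
  · filter_upwards [hnear] with t htt
    refine Continuous.aestronglyMeasurable ?_
    simp only [slope_def_module]
    exact (continuous_const.smul ((hA.continuous_snd (hsub htt.1)).sub
      (hA.continuous_snd ht))).mul (hB.continuous_deriv_snd (hsub htt.1))
  · filter_upwards [hnear] with t htt
    refine ae_of_all _ fun θ hθ => ?_
    rw [norm_mul]
    refine mul_le_mul ?_ ((hM' t htt.2 θ (hI hθ)).trans (le_abs_self _)) (norm_nonneg _)
      (abs_nonneg _)
    have := (convex_closedBall t₀ δ).norm_image_sub_le_of_norm_hasDerivWithin_le
      (f := fun s => A s θ) (C := |M|)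
      (fun s hs => (hA.hasDerivAt_fst (hsub hs) θ).hasDerivWithinAt)
      (fun s hs => (hM s hs θ (hI hθ)).trans (le_abs_self _))
      (Metric.mem_closedBall_self hδ.le) htt.1
    rw [slope_def_module, norm_smul, norm_inv]
    exact inv_mul_le_of_le_mul₀ (norm_nonneg _) (abs_nonneg _) (by rwa [mul_comm])
  · refine ae_of_all _ fun θ hθ => ?_
    refine (hasDerivAt_iff_tendsto_slope.1 (hA.hasDerivAt_fst ht θ)).mul ?_
    have hc := hB.continuousOn_deriv_snd.continuousAt (x := (t₀, θ))
      ((isOpen_strip ε).mem_nhds ⟨ht, mem_univ θ⟩)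
    exact (hc.comp (f := fun t : ℝ => (t, θ)) (by fun_prop)).tendsto.mono_left nhdsWithin_le_nhds

/-- The first variation of `∫ A ∂B` over a period. No mixed second derivatives are needed. -/
theorem hasDerivAt_integral_mul_deriv (hA : IsC1Strip ε A) (hB : IsC1Strip ε B)
    {T : ℝ} (hT : 0 ≤ T) (hAp : ∀ t, Function.Periodic (A t) T)
    (hBp : ∀ t, Function.Periodic (B t) T) {t₀ : ℝ} (ht : t₀ ∈ Ioo (-ε) ε) :
    HasDerivAt (fun t => ∫ θ in (0 : ℝ)..T, A t θ * deriv (B t) θ)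
      (∫ θ in (0 : ℝ)..T, (deriv (fun s => A s θ) t₀ * deriv (B t₀) θ
        - deriv (A t₀) θ * deriv (fun s => B s θ) t₀)) t₀ := by
  -- Split `∫ A_t dB_t` as `∫ (A_t - A_{t₀}) dB_t + ∫ A_{t₀} dB_t`. Integration by parts turns the
  -- second term into `-∫ B_t dA_{t₀}`, where only `B_t` depends on `t`.
  have h1 := hasDerivAt_integral_sub_mul_deriv hA hB ht hT
  have h2 := hB.hasDerivAt_integral_mul (hA.continuous_deriv_snd ht) ht hT
  have h3 := h1.sub h2
  rw [← intervalIntegral.integral_sub] at h3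
  · refine HasDerivAt.congr_of_eventuallyEq (h3.congr_deriv ?_) ?_
    · simp only [mul_comm]
    · filter_upwards [isOpen_Ioo.mem_nhds ht] with t htt
      have hp := intervalIntegral.integral_mul_deriv_eq_deriv_mul (a := 0) (b := T)
        (fun θ _ => hA.hasDerivAt_snd ht θ) (fun θ _ => hB.hasDerivAt_snd htt θ)
        ((hA.continuous_deriv_snd ht).intervalIntegrable _ _)
        ((hB.continuous_deriv_snd htt).intervalIntegrable _ _)
      have e1 : A t₀ T = A t₀ 0 := (hAp t₀).eq
      have e2 : B t T = B t 0 := (hBp t).eq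
      rw [e1, e2, sub_self, zero_sub] at hp
      have : ∫ θ in (0 : ℝ)..T, B t θ * deriv (A t₀) θ = -∫ θ in (0 : ℝ)..T, A t₀ θ * deriv (B t) θ := by
        rw [hp, neg_neg]; simp only [mul_comm]
      simp only [Pi.sub_apply]
      rw [this, sub_neg_eq_add, ← intervalIntegral.integral_add]
      · simp only [sub_mul, sub_add_cancel]
      · exact (((hA.continuous_snd htt).sub (hA.continuous_snd ht)).mul
          (hB.continuous_deriv_snd htt)).intervalIntegrable _ _
      · exact ((hA.continuous_snd ht).mul (hB.continuous_deriv_snd htt)).intervalIntegrable _ _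
  · exact ((hA.continuous_deriv_fst ht).mul (hB.continuous_deriv_snd ht)).intervalIntegrable _ _
  · exact ((hB.continuous_deriv_fst ht).mul (hA.continuous_deriv_snd ht)).intervalIntegrable _ _

theorem periodic_deriv_fst {T : ℝ} (hAp : ∀ t, Function.Periodic (A t) T) (t : ℝ) :
    Function.Periodic (fun θ => deriv (fun s => A s θ) t) T := fun θ => by
  simp only [fun s => hAp s θ]

theorem periodic_deriv_snd {T : ℝ} (hAp : ∀ t, Function.Periodic (A t) T) (t : ℝ) :
    Function.Periodic (deriv (A t)) T := fun θ => by
  rw [← deriv_comp_add_const]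
  congr 1
  ext s; exact hAp t s

end IsC1Strip

/-! ### Reparametrization and the Dirichlet energy -/

theorem periodic_circleExp {X : Type*} (u : Circle → X) :
    Function.Periodic (fun θ : ℝ => u (Circle.exp θ)) (2 * Real.pi) := fun θ => by
  simp only [circleExp_two_pi_add]

theorem periodicCoeff_deriv {P p : ℝ → ℂ} (hP : ∀ θ, HasDerivAt P (p θ) θ) (hp : Continuous p)
    (hper : Function.Periodic P (2 * Real.pi)) (n : ℤ) :
    periodicCoeff p n = Complex.I * n * periodicCoeff P n := by
  have hc : Continuous fun θ : ℝ => Complex.I * (-n : ℤ) * ((Circle.exp θ : Circle) : ℂ) ^ (-n) :=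
    continuous_const.mul (continuous_circleExp_zpow _)
  have h := intervalIntegral.integral_mul_deriv_eq_deriv_mul (a := 0) (b := 2 * Real.pi)
    (fun θ _ => hasDerivAt_circleExp_zpow (-n) θ) (fun θ _ => hP θ)
    (hc.intervalIntegrable _ _) (hp.intervalIntegrable _ _)
  have e1 : P (2 * Real.pi) = P 0 := hper.eq
  rw [e1, Circle.exp_two_pi, Circle.exp_zero, sub_self, zero_sub] at h
  rw [periodicCoeff, periodicCoeff, ← intervalIntegral.integral_const_mul]
  rw [← intervalIntegral.integral_neg] at h
  refine Eq.trans ?_ (h.trans ?_)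
  · simp only [mul_comm]
  · refine intervalIntegral.integral_congr fun θ _ => ?_
    push_cast
    ring

/-- The substitution leads to the integral of `u` from `φ 0` to `φ 0 + 2π`, again a full period.
Only the degree of `φ` matters, not its monotonicity. -/
theorem integral_comp_mul_deriv_of_periodic {u : ℝ → ℂ} (hu : Continuous u)
    (hup : Function.Periodic u (2 * Real.pi)) {φ φ' : ℝ → ℝ}
    (hφ : ∀ x, HasDerivAt φ (φ' x) x) (hφ' : Continuous φ')
    (hφp : ∀ x, φ (x + 2 * Real.pi) = φ x + 2 * Real.pi) :
    ∫ θ in (0 : ℝ)..(2 * Real.pi), u (φ θ) * φ' θ = ∫ θ in (0 : ℝ)..(2 * Real.pi), u θ := by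
  have h := intervalIntegral.integral_deriv_smul_comp (a := 0) (b := 2 * Real.pi)
    (fun x _ => hφ x) hφ'.continuousOn hu
  have h2 : φ (2 * Real.pi) = φ 0 + 2 * Real.pi := by rw [← hφp, zero_add]
  have h3 := hup.intervalIntegral_add_eq (φ 0) 0
  rw [zero_add] at h3
  rw [h2, h3] at h
  rw [← h]
  refine intervalIntegral.integral_congr fun θ _ => ?_
  simp [mul_comm]

/-- The Dirichlet energy `∫ conj P dP` in terms of the Fourier coefficients of `P`. -/
theorem hasSum_energy {P p : ℝ → ℂ} (hP : ∀ θ, HasDerivAt P (p θ) θ) (hp : Continuous p)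
    (hper : Function.Periodic P (2 * Real.pi)) (hpp : Function.Periodic p (2 * Real.pi)) :
    HasSum (fun n : ℤ => (n : ℝ) * Complex.normSq (periodicCoeff P n))
      (2 * Real.pi * (∫ θ in (0 : ℝ)..(2 * Real.pi), (starRingEnd ℂ) (P θ) * p θ).im) := by
  have hPc : Continuous P := continuous_iff_continuousAt.2 fun θ => (hP θ).continuousAt
  have h := hasSum_periodicCoeff_mul (Complex.continuous_conj.comp hPc) hp
    (fun θ => by simp only [Function.comp, hper θ]) hpp
  have h2 := Complex.imCLM.hasSum h
  convert h2 using 1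
  · ext n
    have := conj_periodicCoeff P n
    simp only [Function.comp_def]
    rw [← this, periodicCoeff_deriv hP hp hper]
    have e : (starRingEnd ℂ) (periodicCoeff P n) * (Complex.I * n * periodicCoeff P n)
        = ((n * Complex.normSq (periodicCoeff P n) : ℝ) : ℂ) * Complex.I := by
      push_cast; rw [← Complex.mul_conj]; ring
    rw [e, Complex.imCLM_apply, Complex.im_ofReal_mul, Complex.I_im, mul_one]
  · rw [Complex.imCLM_apply]
    have : (2 * (Real.pi : ℂ)) = ((2 * Real.pi : ℝ) : ℂ) := by push_cast; rfl
    rw [this, Complex.im_ofReal_mul]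
    rfl

/-- A one form on the circle which extends to the disc, and after a change of parameter extends
to the exterior of the disc, is zero. -/
theorem eq_zero_of_periodicCoeff_of_comp {p : ℝ → ℂ} (hp : Continuous p)
    (hpp : Function.Periodic p (2 * Real.pi)) {β β' : ℝ → ℝ} (hβ : ∀ s, HasDerivAt β (β' s) s)
    (hβ' : Continuous β') (hβp : ∀ s, β (s + 2 * Real.pi) = β s + 2 * Real.pi)
    (h1 : ∀ n : ℤ, n ≤ 0 → periodicCoeff p n = 0)
    (h2 : ∀ n : ℤ, 0 ≤ n → periodicCoeff (fun s => p (β s) * β' s) n = 0) : p = 0 := by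
  set P : ℝ → ℂ := fun θ => ∫ x in (0 : ℝ)..θ, p x with hPdef
  have hP : ∀ θ, HasDerivAt P (p θ) θ := fun θ => hp.integral_hasStrictDerivAt 0 θ |>.hasDerivAt
  have hPc : Continuous P := continuous_iff_continuousAt.2 fun θ => (hP θ).continuousAt
  -- The vanishing of mode `0` of `p` is what makes its primitive periodic.
  have hper : Function.Periodic P (2 * Real.pi) := fun θ => by
    have h0 := h1 0 le_rfl
    simp only [periodicCoeff, neg_zero, zpow_zero, mul_one] at h0
    have h3 := hpp.intervalIntegral_add_eq θ 0
    rw [zero_add, h0] at h3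
    simp only [hPdef]
    rw [← intervalIntegral.integral_add_adjacent_intervals (hp.intervalIntegrable 0 θ)
      (hp.intervalIntegrable _ _), h3, add_zero]
  have hβ'p : Function.Periodic β' (2 * Real.pi) := fun s => by
    have e := (hβ (s + 2 * Real.pi)).comp_add_const s (2 * Real.pi)
    have e2 : (fun x => β (x + 2 * Real.pi)) = fun x => β x + 2 * Real.pi := funext hβp
    rw [e2] at e
    exact e.unique ((hβ s).add_const _)
  have hβc : Continuous β := continuous_iff_continuousAt.2 fun θ => (hβ θ).continuousAt
  have hQ : ∀ s, HasDerivAt (fun s => P (β s)) (p (β s) * β' s) s := fun s => by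
    have := HasDerivAt.scomp s (hP (β s)) (hβ s)
    refine this.congr_deriv ?_
    rw [Complex.real_smul, mul_comm]
  have hq : Continuous fun s => p (β s) * (β' s : ℂ) := by fun_prop
  have hQp : Function.Periodic (fun s => P (β s)) (2 * Real.pi) := fun s => by
    simp only [hβp, hper _]
  have hqp : Function.Periodic (fun s => p (β s) * (β' s : ℂ)) (2 * Real.pi) := fun s => by
    simp only [hβp, hpp _, hβ'p s]
  have s1 := hasSum_energy hP hp hper hpp
  have s2 := hasSum_energy hQ hq hQp hqp
  -- The energy integrates the one form `conj P dP`, so it does not see the parametrization.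
  have hE : ∫ s in (0 : ℝ)..(2 * Real.pi), (starRingEnd ℂ) (P (β s)) * (p (β s) * β' s)
      = ∫ θ in (0 : ℝ)..(2 * Real.pi), (starRingEnd ℂ) (P θ) * p θ := by
    have := integral_comp_mul_deriv_of_periodic (u := fun θ => (starRingEnd ℂ) (P θ) * p θ)
      ((Complex.continuous_conj.comp hPc).mul hp) (fun θ => by simp only [hper θ, hpp θ]) hβ hβ' hβp
    rw [← this]
    simp only [mul_assoc]
  rw [hE] at s2
  have n1 : ∀ n : ℤ, 0 ≤ (n : ℝ) * Complex.normSq (periodicCoeff P n) := fun n => by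
    rcases le_or_gt 0 n with hn | hn
    · exact mul_nonneg (by exact_mod_cast hn) (Complex.normSq_nonneg _)
    · have h3 := h1 n hn.le
      rw [periodicCoeff_deriv hP hp hper] at h3
      have : (n : ℂ) ≠ 0 := by exact_mod_cast hn.ne
      have h4 : periodicCoeff P n = 0 := by simpa [this] using h3
      simp [h4]
  have n2 : ∀ n : ℤ, (n : ℝ) * Complex.normSq (periodicCoeff (fun s => P (β s)) n) ≤ 0 := fun n => by
    rcases le_or_gt n 0 with hn | hn
    · exact mul_nonpos_of_nonpos_of_nonneg (by exact_mod_cast hn) (Complex.normSq_nonneg _)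
    · have h3 := h2 n hn.le
      rw [periodicCoeff_deriv hQ hq hQp] at h3
      have : (n : ℂ) ≠ 0 := by exact_mod_cast hn.ne'
      have h4 : periodicCoeff (fun s => P (β s)) n = 0 := by simpa [this] using h3
      simp [h4]
  -- The same number is a sum of nonnegative terms for `P` and of nonpositive terms for `P ∘ β`.
  -- Hence it is zero, and so is each term.
  have hz := le_antisymm (s2.nonpos n2) (s1.nonneg n1)
  rw [hz] at s1
  have hall := (hasSum_zero_iff_of_nonneg n1).1 s1
  refine eq_zero_of_periodicCoeff_eq_zero hp hpp fun n => ?_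
  rw [periodicCoeff_deriv hP hp hper]
  have := congrFun hall n
  simp only [Pi.zero_apply, mul_eq_zero, Complex.normSq_eq_zero, Int.cast_eq_zero] at this
  rcases this with h | h <;> simp [h]

/-! ### Lifts of circle homeomorphisms to the line -/

namespace CircleHomeoC

variable (γ : CircleHomeoC)

/-- The function `θ ↦ γ (e^{iθ})`. -/
noncomputable def param (θ : ℝ) : ℂ := γ.toHomeo (Circle.exp θ)

theorem param_ne_zero (θ : ℝ) : γ.param θ ≠ 0 := Circle.coe_ne_zero _

theorem hasDerivAt_param (θ : ℝ) : HasDerivAt γ.param (deriv γ.param θ) θ :=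
  (γ.contDiff_toHomeo.differentiable one_ne_zero θ).hasDerivAt

theorem continuous_deriv_param : Continuous (deriv γ.param) :=
  γ.contDiff_toHomeo.continuous_deriv le_rfl

theorem continuous_param : Continuous γ.param := γ.contDiff_toHomeo.continuous

theorem periodic_param : Function.Periodic γ.param (2 * Real.pi) :=
  periodic_circleExp fun w => (γ.toHomeo w : ℂ)

/-- The derivative of the angle of `γ (e^{iθ})`. -/
noncomputable def angleDeriv (θ : ℝ) : ℝ := (deriv γ.param θ / (Complex.I * γ.param θ)).re

theorem angleDeriv_pos (θ : ℝ) : 0 < γ.angleDeriv θ := γ.orientation θ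

theorem continuous_angleDeriv : Continuous γ.angleDeriv :=
  Complex.continuous_re.comp (γ.continuous_deriv_param.div
    (continuous_const.mul γ.continuous_param)
    fun θ => mul_ne_zero Complex.I_ne_zero (γ.param_ne_zero θ))

/-- Differentiating `|γ|² = 1` shows that `γ'/(iγ)` is real, so it equals its real part
`angleDeriv`. -/
theorem deriv_param (θ : ℝ) : deriv γ.param θ = Complex.I * γ.param θ * γ.angleDeriv θ := by
  have hne := γ.param_ne_zero θ
  have hn : ∀ s, γ.param s * (starRingEnd ℂ) (γ.param s) = 1 := fun s => by
    rw [Complex.mul_conj, param, Circle.normSq_coe, Complex.ofReal_one]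
  have h1 := (γ.hasDerivAt_param θ).mul (γ.hasDerivAt_param θ).star
  have h2 : HasDerivAt (fun s => γ.param s * star (γ.param s)) 0 θ := by
    have : (fun s => γ.param s * star (γ.param s)) = fun _ => 1 := funext hn
    rw [this]; exact hasDerivAt_const _ _
  have h3 := h1.unique h2
  set d := deriv γ.param θ
  set c := γ.param θ
  have hcc : star c = c⁻¹ := eq_inv_of_mul_eq_one_right (hn θ)
  have him : (d / (Complex.I * c)).im = 0 := by
    rw [← Complex.conj_eq_iff_im, map_div₀, map_mul, Complex.conj_I]
    change star d / (-Complex.I * star c) = _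
    have h4 : star d = - (d * star c) / c := by
      field_simp
      linear_combination h3
    rw [h4, hcc]
    field_simp
  have : d / (Complex.I * c) = γ.angleDeriv θ := by
    apply Complex.ext
    · rfl
    · rw [him, Complex.ofReal_im]
  rw [← this]
  field_simp [Complex.I_ne_zero]

theorem periodic_angleDeriv : Function.Periodic γ.angleDeriv (2 * Real.pi) := fun θ => by
  have h1 : deriv γ.param (θ + 2 * Real.pi) = deriv γ.param θ := by
    rw [← deriv_comp_add_const]
    congr 1; ext s; exact γ.periodic_param s
  simp only [angleDeriv, h1, γ.periodic_param θ]

/-- A lift of `γ` to the real line. -/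
noncomputable def lift (θ : ℝ) : ℝ :=
  Complex.arg (γ.toHomeo 1) + ∫ x in (0 : ℝ)..θ, γ.angleDeriv x

theorem hasDerivAt_lift (θ : ℝ) : HasDerivAt γ.lift (γ.angleDeriv θ) θ :=
  (γ.continuous_angleDeriv.integral_hasStrictDerivAt 0 θ).hasDerivAt.const_add _

theorem continuous_lift : Continuous γ.lift :=
  continuous_iff_continuousAt.2 fun θ => (γ.hasDerivAt_lift θ).continuousAt

theorem strictMono_lift : StrictMono γ.lift :=
  strictMono_of_hasDerivAt_pos γ.hasDerivAt_lift γ.angleDeriv_pos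

/-- The quotient of the two sides has derivative zero and equals `1` at `θ = 0`. -/
theorem exp_lift (θ : ℝ) : Circle.exp (γ.lift θ) = γ.toHomeo (Circle.exp θ) := by
  have hd : ∀ s, HasDerivAt (fun s => γ.param s * ((Circle.exp (γ.lift s) : Circle) : ℂ) ^ (-1 : ℤ)) 0 s := by
    intro s
    have h1 := HasDerivAt.scomp s (hasDerivAt_circleExp_zpow (-1) (γ.lift s)) (γ.hasDerivAt_lift s)
    refine ((γ.hasDerivAt_param s).mul h1).congr_deriv ?_
    rw [deriv_param, Complex.real_smul]
    simp only [Function.comp]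
    push_cast
    ring
  have hconst := is_const_of_deriv_eq_zero (fun s => (hd s).differentiableAt) (fun s => (hd s).deriv)
    θ 0
  have h0 : Circle.exp (γ.lift 0) = γ.toHomeo 1 := by
    simp [lift, Circle.exp_arg]
  simp only [param, h0, Circle.exp_zero, zpow_neg_one] at hconst
  rw [mul_inv_cancel₀ (Circle.coe_ne_zero _)] at hconst
  exact (Circle.ext ((mul_inv_eq_one₀ (Circle.coe_ne_zero _)).1 hconst)).symm

/-- The increment over a period is a constant `2πm`, with `m > 0` by monotonicity. If `m ≥ 2`, the
lift would reach `γ.lift 0 + 2π` strictly inside the period, against the injectivity of `γ`. -/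
theorem lift_add_two_pi (θ : ℝ) : γ.lift (θ + 2 * Real.pi) = γ.lift θ + 2 * Real.pi := by
  have hpi := Real.two_pi_pos
  have hc : ∀ θ, γ.lift (θ + 2 * Real.pi) - γ.lift θ = γ.lift (2 * Real.pi) - γ.lift 0 := by
    intro θ
    have hd : ∀ s, HasDerivAt (fun s => γ.lift (s + 2 * Real.pi) - γ.lift s) 0 s := fun s => by
      have := ((γ.hasDerivAt_lift (s + 2 * Real.pi)).comp_add_const s (2 * Real.pi)).sub
        (γ.hasDerivAt_lift s)
      rwa [γ.periodic_angleDeriv s, sub_self] at this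
    have := is_const_of_deriv_eq_zero (fun s => (hd s).differentiableAt) (fun s => (hd s).deriv) θ 0
    simpa using this
  obtain ⟨m, hm⟩ : ∃ m : ℤ, γ.lift (2 * Real.pi) = γ.lift 0 + m * (2 * Real.pi) := by
    rw [← Circle.exp_eq_exp, exp_lift, exp_lift, Circle.exp_two_pi, Circle.exp_zero]
  have hmono := γ.strictMono_lift hpi
  have hm0 : 0 < m := by
    have : 0 < (m : ℝ) * (2 * Real.pi) := by linarith
    exact_mod_cast pos_of_mul_pos_left this hpi.le
  have hm1 : m = 1 := by
    by_contra hne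
    have hm2 : (2 : ℝ) ≤ m := by exact_mod_cast (show 2 ≤ m by omega)
    have hlt : γ.lift 0 + 2 * Real.pi < γ.lift (2 * Real.pi) := by rw [hm]; nlinarith
    obtain ⟨x, hx, hxe⟩ := intermediate_value_Ioo hpi.le γ.continuous_lift.continuousOn
      (show γ.lift 0 + 2 * Real.pi ∈ Ioo _ _ from ⟨by linarith, hlt⟩)
    have h1 : Circle.exp x = Circle.exp 0 := by
      apply γ.toHomeo.injective
      rw [← exp_lift, ← exp_lift, hxe, circleExp_two_pi_add]
    have := Circle.exp_injOn_Ico (a := 0) (b := 2 * Real.pi) (by simp) ⟨hx.1.le, hx.2⟩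
      ⟨le_rfl, hpi⟩ h1
    exact hx.1.ne' this
  have := hc θ
  rw [hm, hm1] at this
  push_cast at this
  linarith

theorem surjective_lift : Function.Surjective γ.lift := by
  intro s
  obtain ⟨w, hw⟩ := γ.toHomeo.surjective (Circle.exp s)
  obtain ⟨θ, rfl⟩ := Circle.exp_surjective w
  rw [← exp_lift, eq_comm, Circle.exp_eq_exp] at hw
  obtain ⟨m, hm⟩ := hw
  have hp : Function.Periodic (fun x => γ.lift x - x) (2 * Real.pi) := fun x => by
    simp only [lift_add_two_pi]; ring
  have : γ.lift (θ + m * (2 * Real.pi)) - (θ + m * (2 * Real.pi)) = γ.lift θ - θ :=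
    hp.int_mul m θ
  exact ⟨θ + m * (2 * Real.pi), by linarith⟩

/-- The inverse of the lift of `γ`. -/
noncomputable def liftSymm : ℝ ≃o ℝ :=
  (γ.strictMono_lift.orderIsoOfSurjective _ γ.surjective_lift).symm

theorem lift_liftSymm (s : ℝ) : γ.lift (γ.liftSymm s) = s :=
  (γ.strictMono_lift.orderIsoOfSurjective _ γ.surjective_lift).apply_symm_apply s

theorem hasDerivAt_liftSymm (s : ℝ) :
    HasDerivAt γ.liftSymm (γ.angleDeriv (γ.liftSymm s))⁻¹ s :=
  HasDerivAt.of_local_left_inverse γ.liftSymm.continuous.continuousAt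
    (γ.hasDerivAt_lift _) (γ.angleDeriv_pos _).ne' (Eventually.of_forall γ.lift_liftSymm)

theorem liftSymm_add_two_pi (s : ℝ) :
    γ.liftSymm (s + 2 * Real.pi) = γ.liftSymm s + 2 * Real.pi := by
  apply γ.strictMono_lift.injective
  rw [lift_liftSymm, lift_add_two_pi, lift_liftSymm]

theorem exp_liftSymm (s : ℝ) : Circle.exp (γ.liftSymm s) = γ.toHomeo.symm (Circle.exp s) := by
  apply γ.toHomeo.injective
  rw [← exp_lift, lift_liftSymm, Homeomorph.apply_symm_apply]

theorem ext_toHomeo {γ δ : CircleHomeoC} (h : γ.toHomeo = δ.toHomeo) : γ = δ := by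
  cases γ; cases δ; cases h; rfl

/-- The substitution `w = γ(e^{iθ})` removes the inverse map, so that `t_n` can be varied through
`γ` alone. -/
theorem fourierTime_of_pos {n : ℤ} (hn : 0 < n) :
    fourierTime γ n = (1 / (2 * Real.pi * Complex.I * n)) *
      ∫ θ in (0 : ℝ)..(2 * Real.pi),
        ((Circle.exp θ : Circle) : ℂ) ^ (-1 : ℤ) * γ.param θ ^ (-n) * deriv γ.param θ := by
  rw [fourierTime, if_pos hn, circleFourierCoeff]
  have hcont : Continuous fun w : Circle => ((γ.toHomeo.symm w : Circle) : ℂ)⁻¹ :=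
    Continuous.inv₀ (by fun_prop) fun w => Circle.coe_ne_zero _
  have h := integral_comp_mul_deriv_of_periodic
    (u := fun s => ((γ.toHomeo.symm (Circle.exp s) : Circle) : ℂ)⁻¹
      * ((Circle.exp s : Circle) : ℂ) ^ (-(n - 1)))
    ((hcont.comp (by fun_prop)).mul (continuous_circleExp_zpow _))
    (fun s => by simp only [circleExp_two_pi_add]) γ.hasDerivAt_lift γ.continuous_angleDeriv
    γ.lift_add_two_pi
  rw [← h]
  have e : ∀ θ, ((γ.toHomeo.symm (Circle.exp (γ.lift θ)) : Circle) : ℂ)⁻¹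
      * ((Circle.exp (γ.lift θ) : Circle) : ℂ) ^ (-(n - 1)) * γ.angleDeriv θ
      = (1 / Complex.I) * (((Circle.exp θ : Circle) : ℂ) ^ (-1 : ℤ) * γ.param θ ^ (-n)
        * deriv γ.param θ) := fun θ => by
    rw [exp_lift, Homeomorph.symm_apply_apply, deriv_param, ← param, zpow_neg_one, neg_sub,
      sub_eq_add_neg, zpow_add₀ (γ.param_ne_zero θ), zpow_one]
    field_simp [Complex.I_ne_zero]
  simp only [e]
  rw [intervalIntegral.integral_const_mul]
  have hn' : (n : ℂ) ≠ 0 := by exact_mod_cast hn.ne'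
  have hpi : (Real.pi : ℂ) ≠ 0 := by exact_mod_cast Real.pi_ne_zero
  field_simp [Complex.I_ne_zero]

end CircleHomeoC

/-! ### Completeness of the Fourier variables -/

theorem IsC1Strip.circleExp_zpow (ε : ℝ) (n : ℤ) :
    IsC1Strip ε fun _ θ => ((Circle.exp θ : Circle) : ℂ) ^ n := by
  have : ContDiff ℝ 1 fun p : ℝ × ℝ => ((Circle.exp p.2 : Circle) : ℂ) ^ n := by
    simp_rw [coe_circleExp_zpow, Circle.coe_exp]
    refine ContDiff.cexp (ContDiff.mul (Complex.ofRealCLM.contDiff.comp ?_) contDiff_const)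
    exact contDiff_const.mul contDiff_snd
  exact this.contDiffOn

theorem contDiffAt_zpow {z : ℂ} (hz : z ≠ 0) (n : ℤ) : ContDiffAt ℝ 1 (fun w : ℂ => w ^ n) z := by
  obtain ⟨k, rfl | rfl⟩ := n.eq_nat_or_neg
  · simp only [zpow_natCast]; exact contDiffAt_id.pow k
  · simp only [zpow_neg, zpow_natCast]
    exact (contDiffAt_id.pow k).inv (pow_ne_zero _ hz)

theorem IsC1Strip.zpow {ε : ℝ} {A : ℝ → ℝ → ℂ} (hA : IsC1Strip ε A)
    (h0 : ∀ t ∈ Ioo (-ε) ε, ∀ θ, A t θ ≠ 0) (n : ℤ) : IsC1Strip ε fun t θ => A t θ ^ n :=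
  fun p hp => ContDiffAt.comp_contDiffWithinAt (g := fun z : ℂ => z ^ n)
    (f := fun q : ℝ × ℝ => A q.1 q.2) p (contDiffAt_zpow (h0 p.1 hp.1 p.2) n) (hA p hp)

theorem IsC1Strip.mul {ε : ℝ} {A B : ℝ → ℝ → ℂ} (hA : IsC1Strip ε A) (hB : IsC1Strip ε B) :
    IsC1Strip ε fun t θ => A t θ * B t θ := ContDiffOn.mul hA hB

theorem HasDerivAt.zpow' {c : ℝ → ℂ} {c' : ℂ} {t : ℝ} (h : HasDerivAt c c' t) (h0 : c t ≠ 0)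
    (n : ℤ) : HasDerivAt (fun s => c s ^ n) (n * c t ^ (n - 1) * c') t :=
  (hasDerivAt_zpow n _ (Or.inl h0)).comp t h

theorem deriv_param_eq_zero_of_fourierTime {ε : ℝ} {γ : ℝ → CircleHomeoC}
    (hγ : IsC1Family ε (fun t w => ((γ t).toHomeo w : ℂ))) {t₀ : ℝ} (ht : t₀ ∈ Ioo (-ε) ε)
    (h : ∀ n : ℤ, HasDerivAt (fun t => fourierTime (γ t) n) 0 t₀) (w : Circle) :
    HasDerivAt (fun t => ((γ t).toHomeo w : ℂ)) 0 t₀ := by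
  have hpi : (Real.pi : ℂ) ≠ 0 := by exact_mod_cast Real.pi_ne_zero
  have hC : IsC1Strip ε (fun t => (γ t).param) := hγ
  have hCp : ∀ t, Function.Periodic ((γ t).param) (2 * Real.pi) := fun t => (γ t).periodic_param
  set D : ℝ → ℂ := fun θ => deriv (fun t => (γ t).param θ) t₀ with hD
  have hDc : Continuous D := hC.continuous_deriv_fst ht
  have hDp : Function.Periodic D (2 * Real.pi) := IsC1Strip.periodic_deriv_fst hCp t₀
  have hDd : ∀ θ, HasDerivAt (fun t => (γ t).param θ) (D θ) t₀ := hC.hasDerivAt_fst ht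
  have hint : ∀ k : ℤ, HasDerivAt (fun t => circleFourierCoeff (fun w => ((γ t).toHomeo w : ℂ)) k)
      (1 / (2 * Real.pi) * periodicCoeff D k) t₀ := fun k =>
    (hC.hasDerivAt_integral_mul (continuous_circleExp_zpow (-k)) ht Real.two_pi_pos.le).const_mul _
  -- Mode `k` of `γ` belongs to `t_{k-1}`, so the variables with index `≤ 0` control the modes `≤
  -- 1`.
  have hlow : ∀ k : ℤ, k ≤ 1 → periodicCoeff D k = 0 := by
    intro k hk
    rcases hk.eq_or_lt with rfl | hk
    · have h1 := h 0
      simp only [fourierTime, lt_irrefl, if_false, if_true] at h1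
      simpa [hpi] using (hint 1).unique h1
    · have h1 := h (k - 1)
      have e1 : ¬ 0 < k - 1 := by omega
      have e2 : ¬ k - 1 = 0 := by omega
      simp only [fourierTime, e1, e2, if_false, sub_add_cancel] at h1
      have e3 : ((k - 1 : ℤ) : ℂ) ≠ 0 := by exact_mod_cast e2
      have e4 : (k : ℂ) - 1 ≠ 0 := by simpa using e3
      have := ((hint k).const_mul (1 / ((k - 1 : ℤ) : ℂ))).unique h1
      simpa [hpi, e4] using this
  have hhigh : ∀ n : ℤ, 0 < n → ∫ θ in (0 : ℝ)..(2 * Real.pi),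
      ((Circle.exp θ : Circle) : ℂ) ^ (-1 : ℤ) * D θ * (γ t₀).param θ ^ (-n) = 0 := by
    intro n hn
    have h1 := h n
    simp only [CircleHomeoC.fourierTime_of_pos _ hn] at h1
    have hn' : (n : ℂ) ≠ 0 := by exact_mod_cast hn.ne'
    have hz := hC.zpow (fun t _ θ => (γ t).param_ne_zero θ) (-n)
    have hA := (IsC1Strip.circleExp_zpow ε (-1)).mul hz
    have hAp : ∀ t, Function.Periodic (fun θ => ((Circle.exp θ : Circle) : ℂ) ^ (-1 : ℤ)
        * (γ t).param θ ^ (-n)) (2 * Real.pi) := fun t θ => by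
      simp only [circleExp_two_pi_add, hCp t θ]
    have h2 := (hA.hasDerivAt_integral_mul_deriv hC Real.two_pi_pos.le hAp hCp ht).const_mul
      (1 / (2 * Real.pi * Complex.I * n))
    have h3 := h2.unique h1
    have hk : (1 / (2 * Real.pi * Complex.I * n) : ℂ) ≠ 0 := by
      simp [hpi, hn', Complex.I_ne_zero]
    have h4 := (mul_eq_zero.1 h3).resolve_left hk
    -- The two terms containing `∂_θ γ` cancel. What survives comes from the derivative of
    -- `e^{-iθ}`, whence the factor `I`.
    have h5 : ∀ θ : ℝ, deriv (fun s => ((Circle.exp θ : Circle) : ℂ) ^ (-1 : ℤ)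
          * (γ s).param θ ^ (-n)) t₀ * deriv (γ t₀).param θ
        - deriv (fun θ => ((Circle.exp θ : Circle) : ℂ) ^ (-1 : ℤ) * (γ t₀).param θ ^ (-n)) θ
          * deriv (fun s => (γ s).param θ) t₀
        = Complex.I * (((Circle.exp θ : Circle) : ℂ) ^ (-1 : ℤ) * D θ
          * (γ t₀).param θ ^ (-n)) := by
      intro θ
      have d1 := ((hDd θ).zpow' ((γ t₀).param_ne_zero θ) (-n)).const_mul
        (((Circle.exp θ : Circle) : ℂ) ^ (-1 : ℤ))
      have d2 := (hasDerivAt_circleExp_zpow (-1) θ).mul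
        (((γ t₀).hasDerivAt_param θ).zpow' ((γ t₀).param_ne_zero θ) (-n))
      have d3 : deriv (fun θ => ((Circle.exp θ : Circle) : ℂ) ^ (-1 : ℤ) * (γ t₀).param θ ^ (-n)) θ = _ :=
        d2.deriv
      rw [d1.deriv, d3]
      change _ - _ * D θ = _
      push_cast
      ring
    simp only [h5] at h4
    rw [intervalIntegral.integral_const_mul] at h4
    exact (mul_eq_zero.1 h4).resolve_left Complex.I_ne_zero
  -- The energy argument applies with `β` the lift of `γ⁻¹`: mode `n` of the transported form is `∫
  -- e^{-iθ} D γ^{-n} dθ`.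
  have hpzero : (fun θ => ((Circle.exp θ : Circle) : ℂ) ^ (-1 : ℤ) * D θ) = 0 := by
    refine eq_zero_of_periodicCoeff_of_comp ((continuous_circleExp_zpow _).mul hDc)
      (fun θ => by simp only [circleExp_two_pi_add, hDp θ]) (γ t₀).hasDerivAt_liftSymm
      (((γ t₀).continuous_angleDeriv.comp (γ t₀).liftSymm.continuous).inv₀
        fun s => ((γ t₀).angleDeriv_pos _).ne')
      (γ t₀).liftSymm_add_two_pi (fun n hn => ?_) (fun n hn => ?_)
    · rw [periodicCoeff_zpow_mul]; exact hlow _ (by omega)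
    · have hcv := integral_comp_mul_deriv_of_periodic
        (u := fun θ => ((Circle.exp θ : Circle) : ℂ) ^ (-1 : ℤ) * D θ * (γ t₀).param θ ^ (-n))
        (((continuous_circleExp_zpow _).mul hDc).mul
          ((γ t₀).continuous_param.zpow₀ _ fun θ => Or.inl ((γ t₀).param_ne_zero θ)))
        (fun θ => by simp only [circleExp_two_pi_add, hDp θ, hCp t₀ θ])
        (γ t₀).hasDerivAt_liftSymm
        (((γ t₀).continuous_angleDeriv.comp (γ t₀).liftSymm.continuous).inv₀
          fun s => ((γ t₀).angleDeriv_pos _).ne')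
        (γ t₀).liftSymm_add_two_pi
      have hzero : ∫ θ in (0 : ℝ)..(2 * Real.pi),
          ((Circle.exp θ : Circle) : ℂ) ^ (-1 : ℤ) * D θ * (γ t₀).param θ ^ (-n) = 0 := by
        -- The case `n = 0` is mode `1` of `D`, supplied by `t_0`.
        rcases hn.eq_or_lt with rfl | hn
        · have := hlow 1 le_rfl
          rw [periodicCoeff] at this
          rw [← this]
          refine intervalIntegral.integral_congr fun θ _ => ?_
          simp [mul_comm]
        · exact hhigh n hn
      rw [hzero] at hcv
      rw [periodicCoeff, ← hcv]
      refine intervalIntegral.integral_congr fun s _ => ?_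
      have : (γ t₀).param ((γ t₀).liftSymm s) = ((Circle.exp s : Circle) : ℂ) := by
        rw [CircleHomeoC.param, CircleHomeoC.exp_liftSymm, Homeomorph.apply_symm_apply]
      simp only [this]
      ring
  obtain ⟨θ, rfl⟩ := Circle.exp_surjective w
  have := congrFun hpzero θ
  have hD0 : D θ = 0 := by
    simpa [zpow_ne_zero, coe_circleExp_ne_zero] using this
  rw [← hD0]
  exact hDd θ

theorem eq_of_hasDerivAt_zero {ε : ℝ} (hε : 0 < ε) {γ : ℝ → CircleHomeoC}
    (h : ∀ t ∈ Ioo (-ε) ε, ∀ w : Circle, HasDerivAt (fun t => ((γ t).toHomeo w : ℂ)) 0 t)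
    {t : ℝ} (ht : t ∈ Ioo (-ε) ε) : γ t = γ 0 := by
  refine CircleHomeoC.ext_toHomeo (Homeomorph.ext fun w => Circle.ext ?_)
  exact isOpen_Ioo.is_const_of_deriv_eq_zero isPreconnected_Ioo
    (fun s hs => (h s hs w).differentiableAt.differentiableWithinAt)
    (fun s hs => (h s hs w).deriv) ht ⟨by linarith, hε⟩

/-! ### The operator `∂̄` and the Cauchy–Pompeiu formula -/

/-- Twice the Wirtinger derivative `∂h/∂z̄`. -/
noncomputable def dbar (h : ℂ → ℂ) (z : ℂ) : ℂ :=
  fderiv ℝ h z 1 + Complex.I * fderiv ℝ h z Complex.I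

theorem continuous_dbar {h : ℂ → ℂ} (hh : ContDiff ℝ 1 h) : Continuous (dbar h) := by
  have := hh.continuous_fderiv one_ne_zero
  exact (this.clm_apply continuous_const).add
    (continuous_const.mul (this.clm_apply continuous_const))

theorem dbar_eq_zero_of_differentiableAt {h : ℂ → ℂ} {z : ℂ} (hh : DifferentiableAt ℂ h z) :
    dbar h z = 0 := by
  rw [dbar, hh.fderiv_restrictScalars ℝ]
  simp only [ContinuousLinearMap.coe_restrictScalars']
  have : (fderiv ℂ h z) Complex.I = Complex.I * (fderiv ℂ h z) 1 := by
    rw [← smul_eq_mul, ← map_smul, smul_eq_mul, mul_one]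
  rw [this, ← mul_assoc, Complex.I_mul_I]; ring

theorem fderiv_eq_mul_of_dbar_eq_zero {h : ℂ → ℂ} {z : ℂ} (hz : dbar h z = 0) (v : ℂ) :
    fderiv ℝ h z v = fderiv ℝ h z 1 * v := by
  have hI : fderiv ℝ h z Complex.I = Complex.I * fderiv ℝ h z 1 := by
    rw [dbar] at hz
    have : Complex.I * (fderiv ℝ h z 1 + Complex.I * fderiv ℝ h z Complex.I) = 0 := by
      rw [hz, mul_zero]
    rw [mul_add, ← mul_assoc, Complex.I_mul_I] at this
    linear_combination -this
  have hv : v = v.re • (1 : ℂ) + v.im • Complex.I := by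
    simp [Complex.re_add_im]
  conv_lhs => rw [hv]
  rw [map_add, map_smul, map_smul, hI, Complex.real_smul, Complex.real_smul]
  conv_rhs => rw [hv, Complex.real_smul, Complex.real_smul]
  ring

theorem hasDerivAt_of_dbar_eq_zero {h : ℂ → ℂ} {z : ℂ} (hd : DifferentiableAt ℝ h z)
    (hz : dbar h z = 0) : HasDerivAt h (fderiv ℝ h z 1) z := by
  rw [hasDerivAt_iff_hasFDerivAt]
  refine hasFDerivAt_of_restrictScalars ℝ hd.hasFDerivAt ?_
  refine ContinuousLinearMap.ext fun v => ?_
  rw [fderiv_eq_mul_of_dbar_eq_zero hz v]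
  simp [mul_comm]

/-- Since `dbar h` is continuous, the Cauchy–Riemann equation persists on the boundary. This is how
conformality on one side of the circle reaches the circle itself. -/
theorem dbar_eq_zero_of_mem_closure {h : ℂ → ℂ} (hh : ContDiff ℝ 1 h) {U : Set ℂ}
    (hU : ∀ z ∈ U, DifferentiableAt ℂ h z) {z : ℂ} (hz : z ∈ closure U) : dbar h z = 0 := by
  have hc : IsClosed {z | dbar h z = 0} := isClosed_eq (continuous_dbar hh) continuous_const
  exact closure_minimal (fun z hz => dbar_eq_zero_of_differentiableAt (hU z hz)) hc hz

/-- Rotating the frame `(1, i)` to `(e, ie)` multiplies `∂̄` by the conjugate of `e`, which is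
`1/e`. With `e = e^{iφ}` this splits `∂̄` into radial and angular derivatives. -/
theorem fderiv_add_I_mul_fderiv_I_mul (h : ℂ → ℂ) (z e : ℂ) (hn : ‖e‖ = 1) :
    fderiv ℝ h z e + Complex.I * fderiv ℝ h z (Complex.I * e) = dbar h z / e := by
  have hv : e = e.re • (1 : ℂ) + e.im • Complex.I := by simp [Complex.re_add_im]
  have hIe : Complex.I * e = (-e.im) • (1 : ℂ) + e.re • Complex.I := by
    apply Complex.ext <;> simp
  have hinv : e⁻¹ = (e.re : ℂ) - e.im * Complex.I := by
    rw [Complex.inv_def, Complex.normSq_eq_norm_sq, hn]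
    apply Complex.ext <;> simp
  have h1 : fderiv ℝ h z e = e.re * fderiv ℝ h z 1 + e.im * fderiv ℝ h z Complex.I := by
    conv_lhs => rw [hv]
    rw [map_add, map_smul, map_smul, Complex.real_smul, Complex.real_smul]
  rw [hIe, h1, map_add, map_smul, map_smul, Complex.real_smul, Complex.real_smul, div_eq_mul_inv,
    hinv, dbar]
  push_cast
  linear_combination (e.im : ℂ) * (fderiv ℝ h z Complex.I) * Complex.I_mul_I

/-- The angular part `b` integrates to zero over each circle, and the radial part `a` integrates
along rays by the fundamental theorem of calculus. -/
theorem integral_dbar_polar {h : ℂ → ℂ} (hh : ContDiff ℝ 1 h) (z : ℂ) {R : ℝ} (hR : 0 ≤ R) :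
    ∫ p in Ioc 0 R ×ˢ Ioo (-Real.pi) Real.pi,
        dbar h (z + p.1 * (Circle.exp p.2 : Circle)) / ((Circle.exp p.2 : Circle) : ℂ)
      = ∫ φ in (-Real.pi)..Real.pi, (h (z + R * (Circle.exp φ : Circle)) - h z) := by
  have hpi : -Real.pi ≤ Real.pi := by linarith [Real.pi_pos]
  have hfd := hh.continuous_fderiv one_ne_zero
  set a : ℝ × ℝ → ℂ := fun p =>
    fderiv ℝ h (z + p.1 * (Circle.exp p.2 : Circle)) ((Circle.exp p.2 : Circle) : ℂ) with ha
  set b : ℝ × ℝ → ℂ := fun p =>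
    fderiv ℝ h (z + p.1 * (Circle.exp p.2 : Circle)) (Complex.I * (Circle.exp p.2 : Circle)) with hb
  have hac : Continuous a :=
    (hfd.comp (by fun_prop)).clm_apply (by fun_prop)
  have hbc : Continuous b :=
    (hfd.comp (by fun_prop)).clm_apply (by fun_prop)
  have hsub : Ioc 0 R ×ˢ Ioo (-Real.pi) Real.pi ⊆ Icc 0 R ×ˢ Icc (-Real.pi) Real.pi :=
    prod_mono Ioc_subset_Icc_self Ioo_subset_Icc_self
  have hK : IsCompact (Icc 0 R ×ˢ Icc (-Real.pi) Real.pi) := isCompact_Icc.prod isCompact_Icc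
  have hai : IntegrableOn a (Ioc 0 R ×ˢ Ioo (-Real.pi) Real.pi) (volume.prod volume) :=
    (hac.continuousOn.integrableOn_compact hK).mono_set hsub
  have hbi : IntegrableOn b (Ioc 0 R ×ˢ Ioo (-Real.pi) Real.pi) (volume.prod volume) :=
    (hbc.continuousOn.integrableOn_compact hK).mono_set hsub
  have hsplit : (fun p : ℝ × ℝ => dbar h (z + p.1 * (Circle.exp p.2 : Circle))
      / ((Circle.exp p.2 : Circle) : ℂ)) = fun p => a p + Complex.I * b p := by
    ext p
    rw [ha, hb]
    exact (fderiv_add_I_mul_fderiv_I_mul h _ _ (Circle.norm_coe _)).symm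
  have hbz : ∫ p in Ioc 0 R ×ˢ Ioo (-Real.pi) Real.pi, b p ∂(volume.prod volume) = 0 := by
    rw [setIntegral_prod _ hbi]
    refine setIntegral_eq_zero_of_forall_eq_zero fun r hr => ?_
    have hr0 : (r : ℂ) ≠ 0 := by exact_mod_cast hr.1.ne'
    rw [← integral_Ioc_eq_integral_Ioo, ← intervalIntegral.integral_of_le hpi]
    have hd : ∀ φ, HasDerivAt (fun φ : ℝ => (r : ℂ)⁻¹ * h (z + r * (Circle.exp φ : Circle)))
        (b (r, φ)) φ := by
      intro φ
      have h1 := ((hasDerivAt_coe_circleExp φ).const_mul (r : ℂ)).const_add z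
      have h2 := ((hh.differentiable one_ne_zero _).hasFDerivAt.comp_hasDerivAt φ h1).const_mul
        ((r : ℂ)⁻¹)
      refine h2.congr_deriv ?_
      have h3 := map_smul (fderiv ℝ h (z + r * (Circle.exp φ : Circle))) r
        (Complex.I * ((Circle.exp φ : Circle) : ℂ))
      rw [Complex.real_smul, Complex.real_smul] at h3
      rw [h3, inv_mul_cancel_left₀ hr0]
    rw [intervalIntegral.integral_eq_sub_of_hasDerivAt (fun φ _ => hd φ)
      ((hbc.comp (by fun_prop : Continuous fun φ : ℝ => (r, φ))).intervalIntegrable _ _)]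
    have : Circle.exp Real.pi = Circle.exp (-Real.pi) := by
      rw [← circleExp_two_pi_add (-Real.pi)]; congr 1; ring
    rw [this, sub_self]
  have haz : ∫ p in Ioc 0 R ×ˢ Ioo (-Real.pi) Real.pi, a p ∂(volume.prod volume)
      = ∫ φ in (-Real.pi)..Real.pi, (h (z + R * (Circle.exp φ : Circle)) - h z) := by
    rw [IntegrableOn, ← Measure.prod_restrict] at hai
    rw [← Measure.prod_restrict, integral_prod_symm _ hai, ← integral_Ioc_eq_integral_Ioo,
      ← intervalIntegral.integral_of_le hpi]
    refine intervalIntegral.integral_congr fun φ _ => ?_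
    rw [← intervalIntegral.integral_of_le hR]
    have hd : ∀ r, HasDerivAt (fun r : ℝ => h (z + r * (Circle.exp φ : Circle))) (a (r, φ)) r := by
      intro r
      have h1 := ((Complex.ofRealCLM.hasDerivAt (x := r)).mul_const
        ((Circle.exp φ : Circle) : ℂ)).const_add z
      have h2 := (hh.differentiable one_ne_zero _).hasFDerivAt.comp_hasDerivAt r h1
      refine h2.congr_deriv ?_
      simp [ha]
    rw [intervalIntegral.integral_eq_sub_of_hasDerivAt (fun r _ => hd r)
      ((hac.comp (by fun_prop : Continuous fun r : ℝ => (r, φ))).intervalIntegrable _ _)]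
    simp
  rw [hsplit, Measure.volume_eq_prod, integral_add hai (hbi.const_mul _), integral_const_mul, hbz,
    haz, mul_zero, add_zero]

/-- In polar coordinates about `z` the Jacobian cancels the modulus of `ζ - z`. Beyond radius `R`
the integrand vanishes because there `‖ζ‖ > R₀`. -/
theorem integral_dbar_div_eq_circle {h : ℂ → ℂ} (hh : ContDiff ℝ 1 h) {R₀ : ℝ}
    (hsupp : ∀ ζ, R₀ < ‖ζ‖ → dbar h ζ = 0) (z : ℂ) {R : ℝ} (hR : 0 ≤ R) (hRz : R₀ + ‖z‖ ≤ R) :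
    ∫ ζ, dbar h ζ / (ζ - z)
      = ∫ φ in (-Real.pi)..Real.pi, (h (z + R * (Circle.exp φ : Circle)) - h z) := by
  rw [← integral_dbar_polar hh z hR, ← integral_add_left_eq_self _ z,
    ← Complex.integral_comp_polarCoord_symm, polarCoord_target]
  have hexp : ∀ p : ℝ × ℝ, (Complex.polarCoord.symm p : ℂ)
      = p.1 * ((Circle.exp p.2 : Circle) : ℂ) := fun p => by
    rw [Complex.polarCoord_symm_apply, Circle.coe_exp, Complex.exp_mul_I, Complex.ofReal_cos,
      Complex.ofReal_sin]
  have hm : MeasurableSet (Ioi (0 : ℝ) ×ˢ Ioo (-Real.pi) Real.pi) :=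
    measurableSet_Ioi.prod measurableSet_Ioo
  have h1 : ∫ p in Ioi (0 : ℝ) ×ˢ Ioo (-Real.pi) Real.pi, p.1 •
      (dbar h (z + Complex.polarCoord.symm p) / (z + Complex.polarCoord.symm p - z))
      = ∫ p in Ioi (0 : ℝ) ×ˢ Ioo (-Real.pi) Real.pi,
        dbar h (z + p.1 * (Circle.exp p.2 : Circle)) / ((Circle.exp p.2 : Circle) : ℂ) := by
    refine setIntegral_congr_fun hm fun p hp => ?_
    have hp0 : (p.1 : ℂ) ≠ 0 := by exact_mod_cast (ne_of_gt hp.1)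
    simp only [hexp, add_sub_cancel_left, Complex.real_smul]
    field_simp
  rw [h1]
  refine setIntegral_eq_of_subset_of_forall_sdiff_eq_zero hm
    (prod_mono Ioc_subset_Ioi_self subset_rfl) fun p hp => ?_
  have hp1 : R < p.1 := by
    by_contra hle
    exact hp.2 ⟨⟨hp.1.1, not_lt.1 hle⟩, hp.1.2⟩
  rw [hsupp, zero_div]
  have h2 : ‖(p.1 : ℂ) * (Circle.exp p.2 : Circle)‖ = p.1 := by
    rw [norm_mul, Circle.norm_coe, mul_one, Complex.norm_real, Real.norm_of_nonneg (hR.trans hp1.le)]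
  have h3 := norm_sub_le (z + (p.1 : ℂ) * (Circle.exp p.2 : Circle)) z
  rw [add_sub_cancel_left, h2] at h3
  linarith

/-- The Cauchy–Pompeiu formula for a function which vanishes at infinity and is holomorphic near
infinity. -/
theorem integral_dbar_div {h : ℂ → ℂ} (hh : ContDiff ℝ 1 h) {R₀ : ℝ}
    (hsupp : ∀ ζ, R₀ < ‖ζ‖ → dbar h ζ = 0) (hinf : Tendsto h (Bornology.cobounded ℂ) (𝓝 0))
    (z : ℂ) : ∫ ζ, dbar h ζ / (ζ - z) = -(2 * Real.pi) * h z := by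
  rw [← sub_eq_zero, ← norm_le_zero_iff]
  refine le_of_forall_pos_le_add fun ε hε => ?_
  rw [zero_add]
  have hpos : 0 < ε / (2 * Real.pi) := div_pos hε Real.two_pi_pos
  obtain ⟨R₁, -, hR₁⟩ := (hasBasis_cobounded_norm (E := ℂ)).mem_iff.1
    (hinf (Metric.ball_mem_nhds 0 hpos))
  -- On the circle of radius `R` about `z` both `‖ζ‖ ≥ R₀` and `‖ζ‖ ≥ R₁` hold, so the term with `h`
  -- is at most `ε`.
  set R := max 0 (max (R₀ + ‖z‖) (R₁ + ‖z‖)) with hRdef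
  have hR0 : 0 ≤ R := le_max_left _ _
  have hR1 : R₀ + ‖z‖ ≤ R := (le_max_left _ _).trans (le_max_right _ _)
  have hR2 : R₁ + ‖z‖ ≤ R := (le_max_right _ _).trans (le_max_right _ _)
  have hc : Continuous fun φ : ℝ => h (z + R * (Circle.exp φ : Circle)) :=
    hh.continuous.comp (by fun_prop)
  rw [integral_dbar_div_eq_circle hh hsupp z hR0 hR1,
    intervalIntegral.integral_sub (hc.intervalIntegrable _ _) intervalIntegrable_const,
    intervalIntegral.integral_const]
  have e : (Real.pi - -Real.pi) • h z = 2 * Real.pi * h z := by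
    rw [Complex.real_smul]; push_cast; ring
  rw [e]
  have e2 : ∀ x : ℂ, x - 2 * Real.pi * h z - -(2 * Real.pi) * h z = x := fun x => by ring
  rw [e2]
  have := intervalIntegral.norm_integral_le_of_norm_le_const (a := -Real.pi) (b := Real.pi)
    (f := fun φ : ℝ => h (z + R * (Circle.exp φ : Circle))) (C := ε / (2 * Real.pi))
    fun φ _ => by
      have h2 : ‖(R : ℂ) * (Circle.exp φ : Circle)‖ = R := by
        rw [norm_mul, Circle.norm_coe, mul_one, Complex.norm_real, Real.norm_of_nonneg hR0]
      have h3 := norm_sub_le (z + (R : ℂ) * (Circle.exp φ : Circle)) z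
      rw [add_sub_cancel_left, h2] at h3
      have h4 : z + (R : ℂ) * (Circle.exp φ : Circle) ∈ {x : ℂ | R₁ ≤ ‖x‖} := by
        rw [mem_ofPred_eq]; linarith
      have := hR₁ h4
      rw [mem_preimage, mem_ball_zero_iff] at this
      exact this.le
  refine this.trans (le_of_eq ?_)
  have : Real.pi - -Real.pi = 2 * Real.pi := by ring
  rw [this, abs_of_pos Real.two_pi_pos]
  field_simp

/-! ### Cauchy transforms of measures on a curve -/

theorem integrable_indicator_norm_inv (R : ℝ) :
    Integrable fun η : ℂ => (Iic R).indicator (fun r : ℝ => r⁻¹) ‖η‖ := by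
  rw [integrable_fun_norm_addHaar volume (f := (Iic R).indicator fun r : ℝ => r⁻¹)]
  have h1 : IntegrableOn (fun _ : ℝ => (1 : ℝ)) (Ioc 0 R) := by simp
  have h2 : IntegrableOn ((Ioc 0 R).indicator fun _ : ℝ => (1 : ℝ)) (Ioi 0) :=
    (h1.integrable_indicator measurableSet_Ioc).integrableOn
  refine h2.congr_fun (fun y hy => ?_) measurableSet_Ioi
  have hy0 : y ≠ 0 := ne_of_gt hy
  by_cases hyR : y ≤ R
  · rw [indicator_of_mem (show y ∈ Ioc 0 R from ⟨hy, hyR⟩)]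
    simp [indicator, hyR, hy0]
  · rw [indicator_of_notMem (fun h => hyR h.2)]
    simp [indicator, hyR]

/-- If the Cauchy transform of a measure on a curve vanishes where `h` is not holomorphic, then the
measure annihilates `h`. -/
theorem integral_mul_comp_eq_zero_of_cauchyTransform {h : ℂ → ℂ} (hh : ContDiff ℝ 1 h) {R₀ : ℝ}
    (hsupp : ∀ ζ, R₀ < ‖ζ‖ → dbar h ζ = 0) (hinf : Tendsto h (Bornology.cobounded ℂ) (𝓝 0))
    {κ p : ℝ → ℂ} (hκ : Continuous κ) (hp : Continuous p) {a b : ℝ} (hab : a ≤ b)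
    (hN : ∀ ζ, dbar h ζ ≠ 0 → ∫ θ in a..b, κ θ / (p θ - ζ) = 0) :
    ∫ θ in a..b, κ θ * h (p θ) = 0 := by
  have hdc := continuous_dbar hh
  obtain ⟨M, hM⟩ := (isCompact_closedBall (0 : ℂ) R₀).exists_bound_of_continuousOn hdc.continuousOn
  obtain ⟨P, hP⟩ := (isCompact_Icc (a := a) (b := b)).exists_bound_of_continuousOn hp.continuousOn
  obtain ⟨C, hC⟩ := (isCompact_Icc (a := a) (b := b)).exists_bound_of_continuousOn hκ.continuousOn
  -- A dominating function for Fubini. It bounds the kernel after translation by `p θ`, so its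
  -- integral is the same for all `θ`; the radius `R₀ + P` bounds `‖ζ - p θ‖` wherever `∂̄h ≠ 0`.
  let w : ℂ → ℝ := fun η => |C| * |M| * (Iic (R₀ + P)).indicator (fun r : ℝ => r⁻¹) ‖η‖
  have hw : Integrable w := (integrable_indicator_norm_inv _).const_mul _
  let F : ℝ → ℂ → ℂ := fun θ ζ => κ θ * (dbar h ζ / (ζ - p θ))
  have hbound : ∀ θ ∈ Icc a b, ∀ ζ, ‖F θ ζ‖ ≤ w (ζ - p θ) := by
    intro θ hθ ζ
    simp only [F, w, norm_mul, norm_div, mul_assoc]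
    refine mul_le_mul ((hC θ hθ).trans (le_abs_self _)) ?_ (by positivity) (abs_nonneg _)
    by_cases hζ : ‖ζ‖ ≤ R₀
    · have h1 : ‖ζ - p θ‖ ∈ Iic (R₀ + P) := by
        have := norm_sub_le ζ (p θ)
        have := hP θ hθ
        simp only [mem_Iic]; linarith
      rw [indicator_of_mem h1, div_eq_mul_inv]
      exact mul_le_mul_of_nonneg_right
        ((hM ζ (by simpa using hζ)).trans (le_abs_self _)) (by positivity)
    · rw [hsupp ζ (not_le.1 hζ)]
      simp only [norm_zero, zero_div]
      refine mul_nonneg (abs_nonneg _) ?_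
      rw [indicator_apply]
      split_ifs <;> positivity
  have hm : Measurable (Function.uncurry F) :=
    (hκ.measurable.comp measurable_fst).mul ((hdc.measurable.comp measurable_snd).div
      (measurable_snd.sub (hp.measurable.comp measurable_fst)))
  have hwt : ∀ c : ℂ, Integrable fun ζ => w (ζ - c) := fun c => hw.comp_sub_right c
  have hFi : ∀ θ ∈ Icc a b, Integrable (F θ) := fun θ hθ =>
    (hwt (p θ)).mono' (hm.comp measurable_prodMk_left).aestronglyMeasurable
      (ae_of_all _ (hbound θ hθ))
  have hIcc : ∀ᵐ θ ∂(volume.restrict (Ioc a b)), θ ∈ Icc a b :=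
    (ae_restrict_mem measurableSet_Ioc).mono fun θ hθ => Ioc_subset_Icc_self hθ
  have hint : Integrable (Function.uncurry F) ((volume.restrict (Ioc a b)).prod volume) := by
    rw [integrable_prod_iff hm.aestronglyMeasurable]
    refine ⟨hIcc.mono hFi, ?_⟩
    refine (integrable_const (∫ η, w η)).mono'
      (hm.norm.aestronglyMeasurable.integral_prod_right') ?_
    filter_upwards [hIcc] with θ hθ
    rw [Real.norm_of_nonneg (integral_nonneg fun ζ => norm_nonneg _)]
    refine (integral_mono (hFi θ hθ).norm (hwt (p θ)) (hbound θ hθ)).trans (le_of_eq ?_)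
    exact integral_sub_right_eq_self w (p θ)
  have hswap := integral_integral_swap hint
  have hleft : ∫ θ in Ioc a b, ∫ ζ, F θ ζ = -(2 * Real.pi) * ∫ θ in a..b, κ θ * h (p θ) := by
    rw [intervalIntegral.integral_of_le hab, ← integral_const_mul]
    congr 1
    ext θ
    rw [integral_const_mul, integral_dbar_div hh hsupp hinf]
    ring
  have hright : ∫ ζ, ∫ θ in Ioc a b, F θ ζ = 0 := by
    refine integral_eq_zero_of_ae (ae_of_all _ fun ζ => ?_)
    rw [Pi.zero_apply]
    by_cases hζ : dbar h ζ = 0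
    · simp [F, hζ]
    · have e : ∀ θ, F θ ζ = -dbar h ζ * (κ θ / (p θ - ζ)) := fun θ => by
        simp only [F]
        rw [← neg_sub (p θ) ζ, div_neg]
        ring
      simp only [e]
      rw [← intervalIntegral.integral_of_le hab, intervalIntegral.integral_const_mul, hN ζ hζ,
        mul_zero]
  rw [hleft, hright] at hswap
  refine (mul_eq_zero.1 hswap).resolve_left ?_
  simp [Real.pi_ne_zero]

/-- By hypothesis `∫ q r^N` does not depend on `N`, and it tends to `0`. With `q = κ/(p - ζ)` this
sums the geometric expansion of the Cauchy kernel, whose terms are moments of `κ`. -/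
theorem integral_eq_zero_of_geometric {q r : ℝ → ℂ} {a b : ℝ} (hab : a ≤ b) (hq : Continuous q)
    (hr : Continuous r) (hr1 : ∀ θ ∈ Icc a b, ‖r θ‖ < 1)
    (h : ∀ N : ℕ, ∫ θ in a..b, q θ * r θ ^ N * (1 - r θ) = 0) : ∫ θ in a..b, q θ = 0 := by
  have hI : uIoc a b ⊆ Icc a b := by rw [uIoc_of_le hab]; exact Ioc_subset_Icc_self
  have hconst : ∀ N : ℕ, ∫ θ in a..b, q θ * r θ ^ N = ∫ θ in a..b, q θ := by
    intro N
    induction N with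
    | zero => simp
    | succ N ih =>
      have h1 := h N
      have e : ∀ θ, q θ * r θ ^ N * (1 - r θ) = q θ * r θ ^ N - q θ * r θ ^ (N + 1) :=
        fun θ => by ring
      have hi : ∀ N : ℕ, IntervalIntegrable (fun θ => q θ * r θ ^ N) volume a b := fun N =>
        (hq.mul (hr.pow N)).intervalIntegrable _ _
      simp only [e] at h1
      rw [intervalIntegral.integral_sub (hi N) (hi (N + 1)), sub_eq_zero] at h1
      rw [← h1, ih]
  have hlim : Tendsto (fun N : ℕ => ∫ θ in a..b, q θ * r θ ^ N) atTop
      (𝓝 (∫ _ in a..b, (0 : ℂ))) := by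
    refine intervalIntegral.tendsto_integral_filter_of_dominated_convergence (fun θ => ‖q θ‖)
      (Eventually.of_forall fun N => (hq.mul (hr.pow _)).aestronglyMeasurable)
      (Eventually.of_forall fun N => ae_of_all _ fun θ hθ => ?_)
      (hq.norm.intervalIntegrable _ _) (ae_of_all _ fun θ hθ => ?_)
    · rw [norm_mul, norm_pow]
      exact mul_le_of_le_one_right (norm_nonneg _)
        (pow_le_one₀ (norm_nonneg _) (hr1 θ (hI hθ)).le)
    · simpa using (tendsto_pow_atTop_nhds_zero_of_norm_lt_one (hr1 θ (hI hθ))).const_mul (q θ)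
  simp only [hconst, intervalIntegral.integral_zero] at hlim
  exact tendsto_nhds_unique tendsto_const_nhds hlim

theorem cauchyTransform_eq_zero_of_moments {κ p : ℝ → ℂ} (hκ : Continuous κ) (hp : Continuous p)
    {a b : ℝ} (hab : a ≤ b) (h : ∀ n : ℕ, ∫ θ in a..b, κ θ * p θ ^ n = 0) {ζ : ℂ}
    (hζ : ∀ θ, ‖p θ‖ < ‖ζ‖) : ∫ θ in a..b, κ θ / (p θ - ζ) = 0 := by
  have hζ0 : ζ ≠ 0 := norm_pos_iff.1 ((norm_nonneg _).trans_lt (hζ 0))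
  have hne : ∀ θ, p θ - ζ ≠ 0 := fun θ h0 => (hζ θ).ne (by rw [sub_eq_zero.1 h0])
  refine integral_eq_zero_of_geometric (r := fun θ => p θ / ζ) hab
    (hκ.div (hp.sub continuous_const) hne) (hp.div_const _) (fun θ _ => ?_) fun N => ?_
  · rw [norm_div, div_lt_one (norm_pos_iff.2 hζ0)]; exact hζ θ
  · have e : ∀ θ, κ θ / (p θ - ζ) * (p θ / ζ) ^ N * (1 - p θ / ζ)
        = -(ζ ^ (N + 1))⁻¹ * (κ θ * p θ ^ N) := fun θ => by
      have := hne θ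
      rw [div_pow, pow_succ]
      field_simp
      ring
    simp only [e]
    rw [intervalIntegral.integral_const_mul, h, mul_zero]

theorem cauchyTransform_eq_zero_of_inv_moments {κ p : ℝ → ℂ} (hκ : Continuous κ)
    (hp : Continuous p) {a b : ℝ} (hab : a ≤ b)
    (h : ∀ n : ℕ, ∫ θ in a..b, κ θ * (p θ)⁻¹ ^ (n + 1) = 0) {ζ : ℂ}
    (hζ : ∀ θ, ‖ζ‖ < ‖p θ‖) : ∫ θ in a..b, κ θ / (p θ - ζ) = 0 := by
  have hp0 : ∀ θ, p θ ≠ 0 := fun θ => norm_pos_iff.1 ((norm_nonneg _).trans_lt (hζ θ))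
  have hne : ∀ θ, p θ - ζ ≠ 0 := fun θ h0 => (hζ θ).ne' (by rw [sub_eq_zero.1 h0])
  refine integral_eq_zero_of_geometric (r := fun θ => ζ / p θ) hab
    (hκ.div (hp.sub continuous_const) hne) (continuous_const.div hp hp0) (fun θ _ => ?_) fun N => ?_
  · rw [norm_div, div_lt_one (norm_pos_iff.2 (hp0 θ))]; exact hζ θ
  · have e : ∀ θ, κ θ / (p θ - ζ) * (ζ / p θ) ^ N * (1 - ζ / p θ)
        = ζ ^ N * (κ θ * (p θ)⁻¹ ^ (N + 1)) := fun θ => by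
      have := hne θ
      have := hp0 θ
      rw [div_pow, pow_succ, inv_pow]
      field_simp
    simp only [e]
    rw [intervalIntegral.integral_const_mul, h, mul_zero]

theorem differentiableOn_cauchyTransform {κ p : ℝ → ℂ} (hκ : Continuous κ) (hp : Continuous p)
    {a b : ℝ} (hab : a ≤ b) {U : Set ℂ} (hU : IsOpen U) (hpU : ∀ θ, p θ ∉ U) :
    DifferentiableOn ℂ (fun ζ => ∫ θ in a..b, κ θ / (p θ - ζ)) U := by
  intro ζ₀ hζ₀
  obtain ⟨δ, hδ, hsub⟩ := Metric.nhds_basis_closedBall.mem_iff.1 (hU.mem_nhds hζ₀)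
  have hne : ∀ ζ ∈ U, ∀ θ, p θ - ζ ≠ 0 := fun ζ hζ θ h0 => hpU θ (by rwa [sub_eq_zero.1 h0])
  have hI : uIoc a b ⊆ Icc a b := by rw [uIoc_of_le hab]; exact Ioc_subset_Icc_self
  have hcont : ContinuousOn (fun x : ℂ × ℝ => κ x.2 / (p x.2 - x.1) ^ 2)
      (Metric.closedBall ζ₀ δ ×ˢ Icc a b) := by
    refine ContinuousOn.div (by fun_prop) (by fun_prop) fun x hx => ?_
    exact pow_ne_zero _ (hne _ (hsub hx.1) _)
  obtain ⟨M, hM⟩ := ((isCompact_closedBall ζ₀ δ).prod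
    (isCompact_Icc (a := a) (b := b))).exists_bound_of_continuousOn hcont
  have hc : ∀ ζ ∈ U, Continuous fun θ => κ θ / (p θ - ζ) := fun ζ hζ =>
    hκ.div (hp.sub continuous_const) (hne ζ hζ)
  refine (intervalIntegral.hasDerivAt_integral_of_dominated_loc_of_deriv_le
    (F := fun ζ θ => κ θ / (p θ - ζ)) (F' := fun ζ θ => κ θ / (p θ - ζ) ^ 2) (bound := fun _ => M)
    (Metric.closedBall_mem_nhds ζ₀ hδ) ?_ ?_ ?_ ?_ ?_
    ?_).2.differentiableAt.differentiableWithinAt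
  · filter_upwards [hU.mem_nhds hζ₀] with ζ hζ
    exact (hc ζ hζ).aestronglyMeasurable
  · exact (hc ζ₀ hζ₀).intervalIntegrable _ _
  · exact (hκ.div ((hp.sub continuous_const).pow 2)
      fun θ => pow_ne_zero _ (hne ζ₀ hζ₀ θ)).aestronglyMeasurable
  · exact ae_of_all _ fun θ hθ ζ hζ => hM (ζ, θ) ⟨hζ, hI hθ⟩
  · exact intervalIntegrable_const
  · refine ae_of_all _ fun θ _ ζ hζ => ?_
    have h0 := hne ζ (hsub hζ) θ
    have := (hasDerivAt_const ζ (κ θ)).fun_div ((hasDerivAt_id ζ).const_sub (p θ)) h0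
    refine this.congr_deriv ?_
    simp

/-! ### The disc, its exterior and homeomorphisms of the plane -/

theorem isPreconnected_norm_gt_one : IsPreconnected {z : ℂ | 1 < ‖z‖} := by
  have : {z : ℂ | 1 < ‖z‖} = Complex.exp '' {z | 0 < z.re} := by
    ext z
    constructor
    · intro hz
      have hz0 : z ≠ 0 := norm_pos_iff.1 (zero_lt_one.trans hz)
      refine ⟨Complex.log z, ?_, Complex.exp_log hz0⟩
      change 0 < (Complex.log z).re
      rw [Complex.log_re]
      exact Real.log_pos hz
    · rintro ⟨w, hw, rfl⟩
      change 1 < ‖Complex.exp w‖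
      rw [Complex.norm_exp]
      exact Real.one_lt_exp_iff.2 hw
  rw [this]
  exact (convex_halfSpace_re_gt 0).isPreconnected.image _ Complex.continuous_exp.continuousOn

theorem isOpen_norm_gt_one : IsOpen {z : ℂ | 1 < ‖z‖} := isOpen_lt continuous_const continuous_norm

theorem isOpen_norm_lt_one : IsOpen {z : ℂ | ‖z‖ < 1} := isOpen_lt continuous_norm continuous_const

theorem isPreconnected_norm_lt_one : IsPreconnected {z : ℂ | ‖z‖ < 1} := by
  have : {z : ℂ | ‖z‖ < 1} = Metric.ball 0 1 := by ext; simp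
  rw [this]; exact (convex_ball _ _).isPreconnected

theorem closure_norm_lt_one : closure {z : ℂ | ‖z‖ < 1} = {z : ℂ | ‖z‖ ≤ 1} := by
  have : {z : ℂ | ‖z‖ < 1} = Metric.ball 0 1 := by ext; simp
  rw [this, closure_ball _ one_ne_zero]; ext; simp

theorem closure_norm_gt_one : closure {z : ℂ | 1 < ‖z‖} = {z : ℂ | 1 ≤ ‖z‖} := by
  have h1 : {z : ℂ | 1 < ‖z‖} = (Metric.closedBall 0 1)ᶜ := by ext; simp
  rw [h1, closure_compl, interior_closedBall _ one_ne_zero]; ext; simp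

theorem Homeomorph.tendsto_cobounded (F : ℂ ≃ₜ ℂ) :
    Tendsto F (Bornology.cobounded ℂ) (Bornology.cobounded ℂ) := by
  rw [Metric.cobounded_eq_cocompact]
  exact F.isClosedEmbedding.tendsto_cocompact

theorem norm_lt_one_of_isPreconnected {S : Set ℂ} (hS : IsPreconnected S) {τ : ℂ → ℂ}
    (hτ : Continuous τ) (h1 : ∀ z ∈ S, ‖τ z‖ ≠ 1) {z₀ : ℂ} (hz₀ : z₀ ∈ S) (h0 : ‖τ z₀‖ < 1)
    {z : ℂ} (hz : z ∈ S) : ‖τ z‖ < 1 := by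
  by_contra hlt
  obtain ⟨y, hy, hy1⟩ := hS.intermediate_value hz₀ hz (f := fun z => ‖τ z‖) hτ.norm.continuousOn
    ⟨h0.le, not_lt.1 hlt⟩
  exact h1 y hy hy1

/-- If `τ 0` were in the exterior, the connected exterior would be mapped by `τ⁻¹` off the circle,
with one value inside the disc, hence entirely into the disc. But `τ⁻¹` tends to infinity at
infinity. -/
theorem Homeomorph.norm_apply_zero_lt_one (τ : ℂ ≃ₜ ℂ) (h : ∀ z, ‖τ z‖ = 1 ↔ ‖z‖ = 1) :
    ‖τ 0‖ < 1 := by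
  by_contra hlt
  have h0 : ‖τ 0‖ ≠ 1 := fun h1 => by simpa using (h 0).1 h1
  have hgt : 1 < ‖τ 0‖ := lt_of_le_of_ne (not_lt.1 hlt) h0.symm
  have h2 : ∀ y : ℂ, 1 < ‖y‖ → ‖τ.symm y‖ < 1 := fun y hy =>
    norm_lt_one_of_isPreconnected isPreconnected_norm_gt_one τ.symm.continuous
      (fun z hz hz1 => by
        have := (h _).2 hz1
        rw [Homeomorph.apply_symm_apply] at this
        exact (ne_of_gt hz) this) hgt (by simp) hy
  have e1 := (tendsto_norm_cobounded_atTop.comp τ.symm.tendsto_cobounded).eventually_gt_atTop 1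
  have e2 := (tendsto_norm_cobounded_atTop (E := ℂ)).eventually_gt_atTop 1
  obtain ⟨y, hy1, hy2⟩ := (e1.and e2).exists
  exact (h2 y hy2).not_gt hy1

/-- The chain rule for `F.symm ∘ F = id`. It also serves on the circle, where the complex derivative
exists because `dbar F` vanishes there. -/
theorem Homeomorph.deriv_ne_zero {F : ℂ ≃ₜ ℂ} (hs : ContDiff ℝ 1 F.symm) {z F' : ℂ}
    (h : HasDerivAt F F' z) : F' ≠ 0 := by
  rintro rfl
  have h1 := (hs.differentiable one_ne_zero (F z)).hasFDerivAt.comp z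
    (h.hasFDerivAt.restrictScalars ℝ)
  have h2 : (F.symm ∘ F) = id := funext F.symm_apply_apply
  rw [h2] at h1
  have := congrArg (fun L => L 1) (h1.unique (hasFDerivAt_id z))
  simp at this

theorem Homeomorph.differentiableAt_symm {F : ℂ ≃ₜ ℂ} (hs : ContDiff ℝ 1 F.symm) {z : ℂ}
    (h : DifferentiableAt ℂ F z) : DifferentiableAt ℂ F.symm (F z) := by
  refine (HasDerivAt.of_local_left_inverse (f := F) (f' := deriv F z)
    F.symm.continuous.continuousAt ?_ (Homeomorph.deriv_ne_zero hs h.hasDerivAt)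
    (Eventually.of_forall F.apply_symm_apply)).differentiableAt
  rw [Homeomorph.symm_apply_apply]
  exact h.hasDerivAt

/-- `ψ ∘ F⁻¹` is holomorphic, up to the boundary, on the image of the domain on which `ψ` and `F`
are. -/
theorem dbar_comp_symm_eq_zero {F : ℂ ≃ₜ ℂ} (hs : ContDiff ℝ 1 F.symm) {ψ : ℂ → ℂ}
    (hψ : ContDiff ℝ 1 ψ) {U : Set ℂ} (hF : ∀ z ∈ U, DifferentiableAt ℂ F z)
    (hψU : ∀ z ∈ U, DifferentiableAt ℂ ψ z) {ζ : ℂ} (hζ : F.symm ζ ∈ closure U) :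
    dbar (ψ ∘ F.symm) ζ = 0 := by
  refine dbar_eq_zero_of_mem_closure (U := F '' U) (hψ.comp hs) ?_ ?_
  · rintro _ ⟨z, hz, rfl⟩
    refine DifferentiableAt.comp _ ?_ (Homeomorph.differentiableAt_symm hs (hF z hz))
    rw [Homeomorph.symm_apply_apply]
    exact hψU z hz
  · rw [← F.image_closure]
    exact ⟨_, hζ, F.apply_symm_apply ζ⟩

/-! ### Measures annihilating powers of conformal maps -/

theorem eq_zero_on_of_cauchyTransform {κ p : ℝ → ℂ} (hκ : Continuous κ) (hp : Continuous p)
    {a b : ℝ} (hab : a ≤ b) {U : Set ℂ} (hU : IsOpen U) (hUc : IsPreconnected U)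
    (hpU : ∀ θ, p θ ∉ U) {ζ₀ : ℂ} (hζ₀ : ζ₀ ∈ U)
    (h : ∀ᶠ ζ in 𝓝 ζ₀, ∫ θ in a..b, κ θ / (p θ - ζ) = 0) {ζ : ℂ} (hζ : ζ ∈ U) :
    ∫ θ in a..b, κ θ / (p θ - ζ) = 0 :=
  ((differentiableOn_cauchyTransform hκ hp hab hU hpU).analyticOnNhd
    hU).eqOn_zero_of_preconnected_of_eventuallyEq_zero hUc hζ₀ h hζ

theorem exists_norm_bound_circle {F : ℂ → ℂ} (hF : Continuous F) :
    ∃ P : ℝ, ∀ θ : ℝ, ‖F (Circle.exp θ)‖ ≤ P := by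
  obtain ⟨P, hP⟩ := (isCompact_closedBall (0 : ℂ) 1).exists_bound_of_continuousOn hF.continuousOn
  exact ⟨P, fun θ => hP _ (by simp)⟩

/-- A dual form of polynomial approximation. The function `z^k`, cut off and composed with `F⁻¹`,
has `∂̄` supported in the image of the exterior. There the Cauchy transform of `κ` along `F(S¹)`
vanishes: near infinity by the moments, elsewhere by the identity theorem. -/
theorem integral_mul_circleExp_pow_eq_zero {F : ℂ ≃ₜ ℂ} (hs : ContDiff ℝ 1 F.symm)
    (hF : DifferentiableOn ℂ F {z : ℂ | ‖z‖ < 1}) {κ : ℝ → ℂ} (hκ : Continuous κ)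
    (h : ∀ n : ℕ, ∫ θ in (0 : ℝ)..(2 * Real.pi), κ θ * F (Circle.exp θ) ^ n = 0) (k : ℕ) :
    ∫ θ in (0 : ℝ)..(2 * Real.pi), κ θ * ((Circle.exp θ : Circle) : ℂ) ^ k = 0 := by
  have hpc : Continuous fun θ : ℝ => F (Circle.exp θ) := F.continuous.comp (by fun_prop)
  obtain ⟨P, hP⟩ := exists_norm_bound_circle F.continuous
  have e1 := (tendsto_norm_cobounded_atTop.comp F.tendsto_cobounded).eventually_gt_atTop P
  have e2 := (tendsto_norm_cobounded_atTop (E := ℂ)).eventually_gt_atTop 1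
  obtain ⟨z₀, hz₀P, hz₀⟩ := (e1.and e2).exists
  -- The radii keep `ψ = z^k` on a neighbourhood of the closed disc and give it compact support.
  let χ : ContDiffBump (0 : ℂ) := ⟨2, 3, by norm_num, by norm_num⟩
  let ψ : ℂ → ℂ := fun z => (χ z : ℂ) * z ^ k
  have hψ : ContDiff ℝ 1 ψ := (Complex.ofRealCLM.contDiff.comp χ.contDiff).mul (contDiff_id.pow k)
  have hψ1 : ∀ z : ℂ, ‖z‖ < 2 → ψ =ᶠ[𝓝 z] fun z => z ^ k := fun z hz => by
    filter_upwards [Metric.isOpen_ball.mem_nhds (show z ∈ Metric.ball (0 : ℂ) 2 by simpa using hz)]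
      with w hw
    have : χ w = 1 := χ.one_of_mem_closedBall (Metric.ball_subset_closedBall hw)
    simp [ψ, this]
  have hψ0 : ∀ z : ℂ, 3 ≤ ‖z‖ → ψ z = 0 := fun z hz => by
    have : χ z = 0 := χ.zero_of_le_dist (by simpa using hz)
    simp [ψ, this]
  have hh : ContDiff ℝ 1 (ψ ∘ F.symm) := hψ.comp hs
  obtain ⟨R₀, hR₀⟩ := (isCompact_closedBall (0 : ℂ) 3).exists_bound_of_continuousOn
    F.continuous.continuousOn
  have hh0 : ∀ ζ, R₀ < ‖ζ‖ → (ψ ∘ F.symm) ζ = 0 := fun ζ hζ => by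
    refine hψ0 _ ?_
    by_contra hlt
    have := hR₀ (F.symm ζ) (by simpa using (not_le.1 hlt).le)
    rw [F.apply_symm_apply] at this
    exact this.not_gt hζ
  have key := integral_mul_comp_eq_zero_of_cauchyTransform (h := ψ ∘ F.symm) (R₀ := R₀) hh
    (fun ζ hζ => ?_) ?_ hκ hpc Real.two_pi_pos.le fun ζ hζ => ?_
  · rw [← key]
    refine intervalIntegral.integral_congr fun θ _ => ?_
    have := (hψ1 (Circle.exp θ) (by simp)).self_of_nhds
    simp only [Function.comp, F.symm_apply_apply, this]
  · have : ψ ∘ F.symm =ᶠ[𝓝 ζ] fun _ => 0 := by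
      filter_upwards [(isOpen_lt continuous_const continuous_norm).mem_nhds hζ] with w hw
      exact hh0 w hw
    rw [dbar, this.fderiv_eq]
    simp
  · refine tendsto_const_nhds.congr' ?_
    filter_upwards [(tendsto_norm_cobounded_atTop (E := ℂ)).eventually_gt_atTop R₀] with w hw
    exact (hh0 w hw).symm
  · have hout : 1 < ‖F.symm ζ‖ := by
      by_contra hle
      refine hζ (dbar_comp_symm_eq_zero hs hψ (U := {z : ℂ | ‖z‖ < 1})
        (fun z hz => hF.differentiableAt (isOpen_norm_lt_one.mem_nhds hz)) (fun z hz => ?_) ?_)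
      · exact (differentiableAt_pow k).congr_of_eventuallyEq
          (hψ1 z (lt_trans hz one_lt_two))
      · rw [closure_norm_lt_one]; exact not_lt.1 hle
    refine eq_zero_on_of_cauchyTransform (U := F '' {z : ℂ | 1 < ‖z‖}) (ζ₀ := F z₀) hκ hpc
      Real.two_pi_pos.le (F.isOpenMap _ isOpen_norm_gt_one)
      (isPreconnected_norm_gt_one.image _ F.continuous.continuousOn) ?_ ⟨z₀, hz₀, rfl⟩ ?_
      ⟨F.symm ζ, hout, F.apply_symm_apply ζ⟩
    · rintro θ ⟨z, hz, hzθ⟩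
      have := F.injective hzθ
      rw [this] at hz
      simp at hz
    · filter_upwards [(isOpen_lt continuous_const continuous_norm).mem_nhds hz₀P] with w hw
      exact cauchyTransform_eq_zero_of_moments hκ hpc Real.two_pi_pos.le h
        fun θ => (hP θ).trans_lt hw

/-- The mirror image of the preceding argument. The identity theorem now starts at `0`, which lies
in the image of the disc by `h0`, and the exponent `k + 1` makes the test function vanish at
infinity. -/
theorem integral_mul_circleExp_inv_pow_eq_zero {F : ℂ ≃ₜ ℂ} (hs : ContDiff ℝ 1 F.symm)
    (hF : DifferentiableOn ℂ F {z : ℂ | 1 < ‖z‖}) (h0 : ‖F.symm 0‖ < 1) {κ : ℝ → ℂ}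
    (hκ : Continuous κ)
    (h : ∀ n : ℕ, ∫ θ in (0 : ℝ)..(2 * Real.pi), κ θ * (F (Circle.exp θ))⁻¹ ^ (n + 1) = 0) (k : ℕ) :
    ∫ θ in (0 : ℝ)..(2 * Real.pi), κ θ * (((Circle.exp θ : Circle) : ℂ)⁻¹) ^ (k + 1) = 0 := by
  have hpc : Continuous fun θ : ℝ => F (Circle.exp θ) := F.continuous.comp (by fun_prop)
  have hU : IsOpen (F '' {z : ℂ | ‖z‖ < 1}) := F.isOpenMap _ isOpen_norm_lt_one
  have h0U : (0 : ℂ) ∈ F '' {z : ℂ | ‖z‖ < 1} := ⟨_, h0, F.apply_symm_apply 0⟩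
  have hpU : ∀ θ : ℝ, F (Circle.exp θ) ∉ F '' {z : ℂ | ‖z‖ < 1} := by
    rintro θ ⟨z, hz, hzθ⟩
    have := F.injective hzθ
    rw [this] at hz
    simp at hz
  obtain ⟨δ, hδ, hsub⟩ := Metric.isOpen_iff.1 hU 0 h0U
  -- The factor `1 - χ` removes the pole at the origin and is `1` near the closed exterior.
  let χ : ContDiffBump (0 : ℂ) := ⟨1 / 4, 1 / 2, by norm_num, by norm_num⟩
  let ψ : ℂ → ℂ := fun z => (1 - (χ z : ℂ)) * z⁻¹ ^ (k + 1)
  have hψ : ContDiff ℝ 1 ψ := by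
    refine contDiff_iff_contDiffAt.2 fun z => ?_
    rcases eq_or_ne z 0 with rfl | hz
    · have : ψ =ᶠ[𝓝 0] fun _ => 0 := by
        filter_upwards [Metric.ball_mem_nhds (0 : ℂ) (by norm_num : (0 : ℝ) < 1 / 4)] with w hw
        have : χ w = 1 := χ.one_of_mem_closedBall (Metric.ball_subset_closedBall hw)
        simp [ψ, this]
      exact contDiffAt_const.congr_of_eventuallyEq this
    · exact (contDiffAt_const.sub (Complex.ofRealCLM.contDiff.comp χ.contDiff).contDiffAt).mul
        ((contDiffAt_id.inv hz).pow (k + 1))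
  have hψ1 : ∀ z : ℂ, 1 / 2 < ‖z‖ → ψ =ᶠ[𝓝 z] fun z => z⁻¹ ^ (k + 1) := fun z hz => by
    filter_upwards [(isOpen_lt continuous_const continuous_norm).mem_nhds hz] with w hw
    have : χ w = 0 := χ.zero_of_le_dist (by rw [dist_zero_right]; exact le_of_lt hw)
    simp [ψ, this]
  have hψinf : Tendsto ψ (Bornology.cobounded ℂ) (𝓝 0) := by
    have h1 : Tendsto (fun z : ℂ => z⁻¹ ^ (k + 1)) (Bornology.cobounded ℂ) (𝓝 0) := by
      simpa using (tendsto_inv₀_cobounded (α := ℂ)).pow (k + 1)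
    refine h1.congr' ?_
    filter_upwards [(tendsto_norm_cobounded_atTop (E := ℂ)).eventually_gt_atTop (1 / 2)] with w hw
    exact ((hψ1 w hw).self_of_nhds).symm
  have hout : ∀ ζ, dbar (ψ ∘ F.symm) ζ ≠ 0 → ‖F.symm ζ‖ < 1 := by
    intro ζ hζ
    by_contra hle
    refine hζ (dbar_comp_symm_eq_zero hs hψ (U := {z : ℂ | 1 < ‖z‖})
      (fun z hz => hF.differentiableAt (isOpen_norm_gt_one.mem_nhds hz)) (fun z hz => ?_) ?_)
    · have hz' : 1 < ‖z‖ := hz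
      have hz0 : z ≠ 0 := norm_pos_iff.1 (zero_lt_one.trans hz')
      exact ((differentiableAt_inv hz0).pow (k + 1)).congr_of_eventuallyEq
        (hψ1 z (by linarith))
    · rw [closure_norm_gt_one]; exact not_lt.1 hle
  obtain ⟨R₀, hR₀⟩ := (isCompact_closedBall (0 : ℂ) 1).exists_bound_of_continuousOn
    F.continuous.continuousOn
  have key := integral_mul_comp_eq_zero_of_cauchyTransform (h := ψ ∘ F.symm) (R₀ := R₀)
    (hψ.comp hs) (fun ζ hζ => ?_) (hψinf.comp F.symm.tendsto_cobounded) hκ hpc Real.two_pi_pos.le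
    fun ζ hζ => eq_zero_on_of_cauchyTransform hκ hpc Real.two_pi_pos.le hU
      (isPreconnected_norm_lt_one.image _ F.continuous.continuousOn) hpU h0U ?_
      ⟨F.symm ζ, hout ζ hζ, F.apply_symm_apply ζ⟩
  · rw [← key]
    refine intervalIntegral.integral_congr fun θ _ => ?_
    have := (hψ1 (Circle.exp θ) (by norm_num)).self_of_nhds
    simp only [Function.comp, F.symm_apply_apply, this]
  · by_contra hne
    have := hR₀ (F.symm ζ) (by simpa using (hout ζ hne).le)
    rw [F.apply_symm_apply] at this
    exact this.not_gt hζ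
  · filter_upwards [Metric.ball_mem_nhds (0 : ℂ) hδ] with w hw
    refine cauchyTransform_eq_zero_of_inv_moments hκ hpc Real.two_pi_pos.le h fun θ => ?_
    by_contra hle
    refine hpU θ (hsub ?_)
    rw [mem_ball_zero_iff] at hw ⊢
    exact (not_lt.1 hle).trans_lt hw

/-- A measure on the circle which annihilates the powers of the interior map and the negative
powers of the exterior map of a welding is zero. -/
theorem eq_zero_of_moments {F G : ℂ ≃ₜ ℂ} (hFs : ContDiff ℝ 1 F.symm) (hGs : ContDiff ℝ 1 G.symm)
    (hF : DifferentiableOn ℂ F {z : ℂ | ‖z‖ < 1}) (hG : DifferentiableOn ℂ G {z : ℂ | 1 < ‖z‖})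
    (h0 : ‖G.symm 0‖ < 1) {κ : ℝ → ℂ} (hκ : Continuous κ)
    (hκp : Function.Periodic κ (2 * Real.pi))
    (h1 : ∀ n : ℕ, ∫ θ in (0 : ℝ)..(2 * Real.pi), κ θ * F (Circle.exp θ) ^ n = 0)
    (h2 : ∀ n : ℕ, ∫ θ in (0 : ℝ)..(2 * Real.pi), κ θ * (G (Circle.exp θ))⁻¹ ^ (n + 1) = 0) :
    κ = 0 := by
  refine eq_zero_of_periodicCoeff_eq_zero hκ hκp fun n => ?_
  rw [periodicCoeff]
  obtain ⟨k, rfl | rfl⟩ := n.eq_nat_or_neg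
  · rcases k with _ | k
    · simpa using integral_mul_circleExp_pow_eq_zero hFs hF hκ h1 0
    · have := integral_mul_circleExp_inv_pow_eq_zero hGs hG h0 hκ h2 k
      simpa only [zpow_neg, zpow_natCast, inv_pow] using this
  · have := integral_mul_circleExp_pow_eq_zero hFs hF hκ h1 k
    simpa only [neg_neg, zpow_natCast] using this

/-- The first variation of `∫ u^a v^b du`. -/
theorem IsC1Strip.hasDerivAt_integral_zpow_mul_zpow {ε : ℝ} {u v : ℝ → ℝ → ℂ}
    (hu : IsC1Strip ε u) (hv : IsC1Strip ε v) {T : ℝ} (hT : 0 ≤ T)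
    (hup : ∀ t, Function.Periodic (u t) T) (hvp : ∀ t, Function.Periodic (v t) T)
    (hu0 : ∀ t ∈ Ioo (-ε) ε, ∀ θ, u t θ ≠ 0) (hv0 : ∀ t ∈ Ioo (-ε) ε, ∀ θ, v t θ ≠ 0)
    {t₀ : ℝ} (ht : t₀ ∈ Ioo (-ε) ε) (a b : ℤ) :
    HasDerivAt (fun t => ∫ θ in (0 : ℝ)..T, u t θ ^ a * v t θ ^ b * deriv (u t) θ)
      (∫ θ in (0 : ℝ)..T, -b * (u t₀ θ ^ a * v t₀ θ ^ (b - 1) *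
        (deriv (fun s => u s θ) t₀ * deriv (v t₀) θ
          - deriv (fun s => v s θ) t₀ * deriv (u t₀) θ))) t₀ := by
  have h := ((hu.zpow hu0 a).mul (hv.zpow hv0 b)).hasDerivAt_integral_mul_deriv hu hT
    (fun t θ => by simp only [hup t θ, hvp t θ]) hup ht
  -- The terms with factor `a` cancel. The variation of `v^b` remains, multiplied by the Jacobian of
  -- `(u, v)` in `(t, θ)`.
  refine h.congr_deriv (intervalIntegral.integral_congr fun θ _ => ?_)
  have du := (hu.hasDerivAt_fst ht θ).zpow' (hu0 t₀ ht θ) a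
  have dv := (hv.hasDerivAt_fst ht θ).zpow' (hv0 t₀ ht θ) b
  have du' := (hu.hasDerivAt_snd ht θ).zpow' (hu0 t₀ ht θ) a
  have dv' := (hv.hasDerivAt_snd ht θ).zpow' (hv0 t₀ ht θ) b
  have e1 : deriv (fun s => u s θ ^ a * v s θ ^ b) t₀ = _ := (du.mul dv).deriv
  have e2 : deriv (fun x => u t₀ x ^ a * v t₀ x ^ b) θ = _ := (du'.mul dv').deriv
  simp only [e1, e2]
  ring

/-! ### Fourier modes of boundary values on the disc and its exterior -/

theorem integral_circleExp_eq {V : ℂ → ℂ} (hV : DiffContOnCl ℂ V (Metric.ball 0 1)) :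
    ∫ θ in (0 : ℝ)..(2 * Real.pi), V (Circle.exp θ) = 2 * Real.pi * V 0 := by
  have h := hV.circleIntegral_sub_inv_smul (Metric.mem_ball_self one_pos)
  rw [circleIntegral] at h
  have e : ∀ θ : ℝ, deriv (circleMap 0 1) θ • ((circleMap 0 1 θ - 0)⁻¹ • V (circleMap 0 1 θ))
      = Complex.I * V (Circle.exp θ) := fun θ => by
    have h0 : circleMap 0 1 θ = ((Circle.exp θ : Circle) : ℂ) := by
      rw [circleMap, Circle.coe_exp]; simp
    have := coe_circleExp_ne_zero θ
    rw [deriv_circleMap, h0, sub_zero, smul_eq_mul, smul_eq_mul]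
    field_simp
  simp only [e] at h
  rw [smul_eq_mul] at h
  rw [intervalIntegral.integral_const_mul] at h
  apply mul_left_cancel₀ Complex.I_ne_zero
  rw [h]; ring

theorem diffContOnCl_of_continuous {V : ℂ → ℂ} (hc : Continuous V)
    (hd : DifferentiableOn ℂ V {z | ‖z‖ < 1}) : DiffContOnCl ℂ V (Metric.ball 0 1) := by
  have : {z : ℂ | ‖z‖ < 1} = Metric.ball 0 1 := by ext; simp
  rw [this] at hd
  exact ⟨hd, hc.continuousOn⟩

theorem integral_circleExp_pow_mul_eq {V : ℂ → ℂ} (hV : DiffContOnCl ℂ V (Metric.ball 0 1))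
    (k : ℕ) : ∫ θ in (0 : ℝ)..(2 * Real.pi), V (Circle.exp θ) * ((Circle.exp θ : Circle) : ℂ) ^ k
      = 2 * Real.pi * (V 0 * 0 ^ k) := by
  have hp : DiffContOnCl ℂ (fun z : ℂ => z ^ k) (Metric.ball 0 1) :=
    (differentiable_pow k).diffContOnCl
  have := integral_circleExp_eq (hp.smul hV)
  simp only [smul_eq_mul] at this
  simpa only [mul_comm] using this

/-- Negative Fourier modes of boundary values of functions on the disc vanish. -/
theorem periodicCoeff_of_diffContOnCl {V : ℂ → ℂ} (hV : DiffContOnCl ℂ V (Metric.ball 0 1))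
    {n : ℤ} (hn : n < 0) : periodicCoeff (fun θ => V (Circle.exp θ)) n = 0 := by
  have h := integral_circleExp_pow_mul_eq hV (-n).toNat
  have e : ((-n).toNat : ℤ) = -n := Int.toNat_of_nonneg (by omega)
  rw [zero_pow (by omega), mul_zero, mul_zero] at h
  rw [periodicCoeff, ← h]
  refine intervalIntegral.integral_congr fun θ _ => ?_
  rw [← zpow_natCast, e]

theorem integral_comp_neg_of_periodic {u : ℝ → ℂ} (hup : Function.Periodic u (2 * Real.pi)) :
    ∫ θ in (0 : ℝ)..(2 * Real.pi), u (-θ) = ∫ θ in (0 : ℝ)..(2 * Real.pi), u θ := by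
  rw [intervalIntegral.integral_comp_neg]
  have := hup.intervalIntegral_add_eq (-(2 * Real.pi)) 0
  simpa using this

/-- Positive Fourier modes of boundary values of functions on the exterior of the disc vanish. -/
theorem periodicCoeff_inv_of_diffContOnCl {V : ℂ → ℂ}
    (hV : DiffContOnCl ℂ V (Metric.ball 0 1)) (k : ℕ) :
    periodicCoeff (fun θ => V (((Circle.exp θ : Circle) : ℂ)⁻¹)) k
      = 2 * Real.pi * (V 0 * 0 ^ k) := by
  rw [← integral_circleExp_pow_mul_eq hV k, periodicCoeff,
    ← integral_comp_neg_of_periodic (u := fun θ : ℝ => V (Circle.exp θ)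
      * ((Circle.exp θ : Circle) : ℂ) ^ k) (fun θ => by simp only [circleExp_two_pi_add])]
  refine intervalIntegral.integral_congr fun θ _ => ?_
  simp only [Circle.exp_neg, Circle.coe_inv, zpow_neg, zpow_natCast, inv_pow]

theorem periodicCoeff_inv_of_diffContOnCl_of_pos {V : ℂ → ℂ}
    (hV : DiffContOnCl ℂ V (Metric.ball 0 1)) {n : ℤ} (hn : 0 < n) :
    periodicCoeff (fun θ => V (((Circle.exp θ : Circle) : ℂ)⁻¹)) n = 0 := by
  lift n to ℕ using hn.le
  rw [periodicCoeff_inv_of_diffContOnCl hV, zero_pow (by omega), mul_zero, mul_zero]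

/-- The derivative along the circle of a map which is conformal on one side of the circle. -/
theorem hasDerivAt_comp_circleExp {F : ℂ → ℂ} (hF : ContDiff ℝ 1 F) {θ : ℝ}
    (hd : dbar F (Circle.exp θ) = 0) :
    HasDerivAt (fun s : ℝ => F (Circle.exp s))
      (Complex.I * Circle.exp θ * fderiv ℝ F (Circle.exp θ) 1) θ := by
  have := (hF.differentiable one_ne_zero _).hasFDerivAt.comp_hasDerivAt θ
    (hasDerivAt_coe_circleExp θ)
  refine this.congr_deriv ?_
  rw [fderiv_eq_mul_of_dbar_eq_zero hd, mul_comm]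

theorem Homeomorph.fderiv_one_ne_zero {F : ℂ ≃ₜ ℂ} (hF : ContDiff ℝ 1 F)
    (hs : ContDiff ℝ 1 F.symm) {z : ℂ} (hd : dbar F z = 0) : fderiv ℝ F z 1 ≠ 0 :=
  Homeomorph.deriv_ne_zero hs
    (hasDerivAt_of_dbar_eq_zero (hF.differentiable one_ne_zero z) hd)

theorem dbar_eq_zero_of_norm_le_one {F : ℂ → ℂ} (hF : ContDiff ℝ 1 F)
    (hd : DifferentiableOn ℂ F {z | ‖z‖ < 1}) {z : ℂ} (hz : ‖z‖ ≤ 1) : dbar F z = 0 :=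
  dbar_eq_zero_of_mem_closure hF
    (fun _ hy => hd.differentiableAt (isOpen_norm_lt_one.mem_nhds hy))
    (by rw [closure_norm_lt_one]; exact hz)

theorem dbar_eq_zero_of_one_le_norm {F : ℂ → ℂ} (hF : ContDiff ℝ 1 F)
    (hd : DifferentiableOn ℂ F {z | 1 < ‖z‖}) {z : ℂ} (hz : 1 ≤ ‖z‖) : dbar F z = 0 :=
  dbar_eq_zero_of_mem_closure hF
    (fun _ hy => hd.differentiableAt (isOpen_norm_gt_one.mem_nhds hy))
    (by rw [closure_norm_gt_one]; exact hz)

/-- The real derivative is used because it is continuous on the whole plane; in the disc it is the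
complex derivative, and it has no zero on the closed disc. -/
theorem diffContOnCl_inv_fderiv {F : ℂ ≃ₜ ℂ} (hF : ContDiff ℝ 1 F) (hs : ContDiff ℝ 1 F.symm)
    (hd : DifferentiableOn ℂ F {z | ‖z‖ < 1}) :
    DiffContOnCl ℂ (fun z => (fderiv ℝ F z 1)⁻¹) (Metric.ball 0 1) := by
  have hb : {z : ℂ | ‖z‖ < 1} = Metric.ball 0 1 := by ext; simp
  have hc : Continuous fun z => fderiv ℝ F z 1 :=
    (hF.continuous_fderiv one_ne_zero).clm_apply continuous_const
  have hne : ∀ z : ℂ, ‖z‖ ≤ 1 → fderiv ℝ F z 1 ≠ 0 := fun z hz =>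
    Homeomorph.fderiv_one_ne_zero hF hs (dbar_eq_zero_of_norm_le_one hF hd hz)
  have hderiv : ∀ z : ℂ, ‖z‖ ≤ 1 → HasDerivAt F (fderiv ℝ F z 1) z := fun z hz =>
    hasDerivAt_of_dbar_eq_zero (hF.differentiable one_ne_zero z)
      (dbar_eq_zero_of_norm_le_one hF hd hz)
  refine ⟨?_, ?_⟩
  · rw [← hb]
    have h1 : DifferentiableOn ℂ (fun z => (deriv F z)⁻¹) {z | ‖z‖ < 1} :=
      (hd.deriv isOpen_norm_lt_one).fun_inv fun z hz => by
        rw [(hderiv z (le_of_lt hz)).deriv]; exact hne z (le_of_lt hz)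
    exact h1.congr fun z hz => by rw [(hderiv z (le_of_lt hz)).deriv]
  · rw [closure_ball _ one_ne_zero]
    exact hc.continuousOn.inv₀ fun z hz => hne z (by simpa using hz)

/-- `z G(1/z)`, extended to the origin. -/
noncomputable def inversion (G : ℂ → ℂ) (b : ℂ) : ℂ → ℂ :=
  Function.update (fun z => z * G z⁻¹) 0 b

theorem inversion_zero (G : ℂ → ℂ) (b : ℂ) : inversion G b 0 = b := Function.update_self ..

theorem inversion_of_ne (G : ℂ → ℂ) (b : ℂ) {z : ℂ} (hz : z ≠ 0) :
    inversion G b z = z * G z⁻¹ := Function.update_of_ne hz ..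

theorem one_lt_norm_inv {z : ℂ} (hz : ‖z‖ < 1) (h0 : z ≠ 0) : 1 < ‖z⁻¹‖ := by
  rw [norm_inv]; exact (one_lt_inv₀ (norm_pos_iff.2 h0)).2 hz

theorem continuousAt_inversion {G : ℂ → ℂ} (hG : Continuous G) {b : ℂ}
    (hb : Tendsto (fun z => G z / z) (Bornology.cobounded ℂ) (𝓝 b)) (z : ℂ) :
    ContinuousAt (inversion G b) z := by
  rcases eq_or_ne z 0 with rfl | hz
  · rw [inversion, continuousAt_update_same]
    refine (hb.comp tendsto_inv₀_nhdsNE_zero).congr fun z => ?_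
    simp [div_eq_mul_inv, mul_comm]
  · have : ContinuousAt (fun z : ℂ => z * G z⁻¹) z :=
      continuousAt_id.mul (hG.continuousAt.comp (continuousAt_inv₀ hz))
    refine this.congr ?_
    filter_upwards [isOpen_ne.mem_nhds hz] with w hw
    exact (inversion_of_ne G b hw).symm

theorem differentiableOn_inversion {G : ℂ → ℂ} (hG : Continuous G)
    (hd : DifferentiableOn ℂ G {z | 1 < ‖z‖}) {b : ℂ}
    (hb : Tendsto (fun z => G z / z) (Bornology.cobounded ℂ) (𝓝 b)) :
    DifferentiableOn ℂ (inversion G b) (Metric.ball 0 1) := by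
  refine (Complex.differentiableOn_compl_singleton_and_continuousAt_iff
    (Metric.ball_mem_nhds 0 one_pos)).1 ⟨?_, continuousAt_inversion hG hb 0⟩
  rintro z ⟨hz1, hz0⟩
  have hz0 : z ≠ 0 := hz0
  have hg : DifferentiableAt ℂ G z⁻¹ := hd.differentiableAt
    (isOpen_norm_gt_one.mem_nhds (one_lt_norm_inv (by simpa using hz1) hz0))
  have : DifferentiableAt ℂ (fun z : ℂ => z * G z⁻¹) z :=
    differentiableAt_id.mul (hg.comp z (differentiableAt_inv hz0))
  refine (this.congr_of_eventuallyEq ?_).differentiableWithinAt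
  filter_upwards [isOpen_ne.mem_nhds hz0] with w hw
  exact inversion_of_ne G b hw

theorem diffContOnCl_inversion {G : ℂ → ℂ} (hG : Continuous G)
    (hd : DifferentiableOn ℂ G {z | 1 < ‖z‖}) {b : ℂ}
    (hb : Tendsto (fun z => G z / z) (Bornology.cobounded ℂ) (𝓝 b)) :
    DiffContOnCl ℂ (inversion G b) (Metric.ball 0 1) :=
  ⟨differentiableOn_inversion hG hd hb,
    (continuous_iff_continuousAt.2 (continuousAt_inversion hG hb)).continuousOn⟩

/-- Differentiate `G(w) = w W(1/w)` with `W = inversion G b`. The resulting expression is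
holomorphic at `z = 0`, with value `b`, and so describes `G'` near infinity. -/
theorem deriv_eq_of_inversion {G : ℂ → ℂ} (hG : Continuous G)
    (hd : DifferentiableOn ℂ G {z | 1 < ‖z‖}) {b : ℂ}
    (hb : Tendsto (fun z => G z / z) (Bornology.cobounded ℂ) (𝓝 b)) {z : ℂ} (hz : ‖z‖ < 1)
    (h0 : z ≠ 0) : HasDerivAt G (inversion G b z - z * deriv (inversion G b) z) z⁻¹ := by
  have hW : HasDerivAt (inversion G b) (deriv (inversion G b) z) (z⁻¹)⁻¹ := by
    rw [inv_inv]
    exact ((differentiableOn_inversion hG hd hb).differentiableAt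
      (Metric.isOpen_ball.mem_nhds (by simpa using hz))).hasDerivAt
  have h1 := (hasDerivAt_id z⁻¹).mul (hW.comp z⁻¹ (hasDerivAt_inv (inv_ne_zero h0)))
  refine (h1.congr_of_eventuallyEq ?_).congr_deriv ?_
  · filter_upwards [isOpen_ne.mem_nhds (inv_ne_zero h0)] with w hw
    have hw' : w ≠ 0 := hw
    simp only [Pi.mul_apply, id, Function.comp, inversion_of_ne G b (inv_ne_zero hw'), inv_inv]
    field_simp
  · simp only [Function.comp, id, inv_inv]
    field_simp
    ring

/-- The reciprocal of the derivative of the exterior map extends over infinity. -/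
theorem exists_diffContOnCl_inv_fderiv {G : ℂ ≃ₜ ℂ} (hG : ContDiff ℝ 1 G)
    (hs : ContDiff ℝ 1 G.symm) (hd : DifferentiableOn ℂ G {z | 1 < ‖z‖}) {b : ℂ} (hb0 : b ≠ 0)
    (hb : Tendsto (fun z => G z / z) (Bornology.cobounded ℂ) (𝓝 b)) :
    ∃ V : ℂ → ℂ, DiffContOnCl ℂ V (Metric.ball 0 1) ∧
      ∀ z : ℂ, ‖z‖ = 1 → V z⁻¹ = (fderiv ℝ G z 1)⁻¹ := by
  set W := inversion G b
  have hWd : DifferentiableOn ℂ W (Metric.ball 0 1) := differentiableOn_inversion hG.continuous hd hb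
  have hc : Continuous fun z => fderiv ℝ G z 1 :=
    (hG.continuous_fderiv one_ne_zero).clm_apply continuous_const
  have hne : ∀ z : ℂ, 1 ≤ ‖z‖ → fderiv ℝ G z 1 ≠ 0 := fun z hz =>
    Homeomorph.fderiv_one_ne_zero hG hs (dbar_eq_zero_of_one_le_norm hG hd hz)
  have hderiv : ∀ z : ℂ, 1 ≤ ‖z‖ → HasDerivAt G (fderiv ℝ G z 1) z := fun z hz =>
    hasDerivAt_of_dbar_eq_zero (hG.differentiable one_ne_zero z)
      (dbar_eq_zero_of_one_le_norm hG hd hz)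
  -- The value `b⁻¹` at `0` is forced: near `0`, `V` is the reciprocal of `W - z W'`, which equals
  -- `b` there.
  let V : ℂ → ℂ := Function.update (fun z => (fderiv ℝ G z⁻¹ 1)⁻¹) 0 b⁻¹
  have hVne : ∀ z, z ≠ 0 → V z = (fderiv ℝ G z⁻¹ 1)⁻¹ := fun z hz => Function.update_of_ne hz ..
  have hX : ∀ z ∈ Metric.ball (0 : ℂ) 1, V z = (W z - z * deriv W z)⁻¹
      ∧ W z - z * deriv W z ≠ 0 := by
    intro z hz
    rcases eq_or_ne z 0 with rfl | h0
    · rw [show V 0 = b⁻¹ from Function.update_self .., show W 0 = b from inversion_zero G b]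
      simp [hb0]
    · have hz1 : ‖z‖ < 1 := by simpa using hz
      have h1 := (deriv_eq_of_inversion hG.continuous hd hb hz1 h0).unique
        (hderiv z⁻¹ (one_lt_norm_inv hz1 h0).le)
      have h2 : W z - z * deriv W z = fderiv ℝ G z⁻¹ 1 := h1
      rw [hVne z h0, h2]
      exact ⟨rfl, hne _ (one_lt_norm_inv hz1 h0).le⟩
  have hVd : DifferentiableOn ℂ V (Metric.ball 0 1) := by
    have h1 : DifferentiableOn ℂ (fun z => (W z - z * deriv W z)⁻¹) (Metric.ball 0 1) :=
      (hWd.sub (differentiableOn_id.mul (hWd.deriv Metric.isOpen_ball))).fun_inv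
        fun z hz => (hX z hz).2
    exact h1.congr fun z hz => (hX z hz).1
  refine ⟨V, ⟨hVd, ?_⟩, fun z hz => ?_⟩
  · rw [closure_ball _ one_ne_zero]
    intro z hz
    rcases eq_or_ne z 0 with rfl | h0
    · exact (hVd.differentiableAt
        (Metric.ball_mem_nhds 0 one_pos)).continuousAt.continuousWithinAt
    · have hz1 : 1 ≤ ‖z⁻¹‖ := by
        rw [norm_inv]; exact (one_le_inv₀ (norm_pos_iff.2 h0)).2 (by simpa using hz)
      have : ContinuousAt (fun z : ℂ => (fderiv ℝ G z⁻¹ 1)⁻¹) z :=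
        (hc.continuousAt.comp (continuousAt_inv₀ h0)).inv₀ (hne _ hz1)
      refine (this.congr ?_).continuousWithinAt
      filter_upwards [isOpen_ne.mem_nhds h0] with w hw
      exact (hVne w hw).symm
  · have h0 : z ≠ 0 := norm_pos_iff.1 (by rw [hz]; exact one_pos)
    rw [hVne _ (inv_ne_zero h0), inv_inv]

theorem Circle.exists_coe_eq {z : ℂ} (hz : ‖z‖ = 1) :
    ∃ w : Circle, (w : ℂ) = z := ⟨⟨z, by simpa [Submonoid.unitSphere] using hz⟩, rfl⟩

/-! ### Fourier modes of normalized weldings -/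

namespace IsConformalWelding

variable {γ : CircleHomeoC} {f g : ℂ ≃ₜ ℂ}

theorem apply_eq (h : IsConformalWelding γ f g) (w : Circle) : f w = g (γ.toHomeo w) := by
  rw [← h.welding w, g.apply_symm_apply]

theorem f_ne_zero (h : IsConformalWelding γ f g) (w : Circle) : f w ≠ 0 := fun h0 =>
  Circle.coe_ne_zero w (f.injective (h0.trans h.f_zero.symm))

theorem g_ne_zero (h : IsConformalWelding γ f g) (w : Circle) : g w ≠ 0 := by
  have := h.apply_eq (γ.toHomeo.symm w)
  rw [Homeomorph.apply_symm_apply] at this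
  rw [← this]
  exact h.f_ne_zero _

/-- The homeomorphism `g⁻¹ ∘ f` preserves the circle and sends `0` to `g⁻¹(0)`, since `f(0) = 0`. -/
theorem norm_g_symm_zero (h : IsConformalWelding γ f g) : ‖g.symm 0‖ < 1 := by
  have := Homeomorph.norm_apply_zero_lt_one (f.trans g.symm) fun z => ?_
  · simpa [h.f_zero] using this
  · simp only [Homeomorph.trans_apply]
    constructor
    · intro hz
      obtain ⟨w, hw⟩ := Circle.exists_coe_eq hz
      have h1 := h.welding (γ.toHomeo.symm w)
      rw [Homeomorph.apply_symm_apply, hw] at h1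
      have := f.injective (g.symm.injective h1)
      rw [← this, Circle.norm_coe]
    · intro hz
      obtain ⟨w, rfl⟩ := Circle.exists_coe_eq hz
      rw [h.welding, Circle.norm_coe]

theorem diffContOnCl_f (h : IsConformalWelding γ f g) : DiffContOnCl ℂ f (Metric.ball 0 1) :=
  diffContOnCl_of_continuous f.continuous h.holo_f

theorem periodicCoeff_f_of_nonpos (h : IsConformalWelding γ f g) {n : ℤ} (hn : n ≤ 0) :
    periodicCoeff (fun θ => f (Circle.exp θ)) n = 0 := by
  rcases hn.eq_or_lt with rfl | hn
  · have := integral_circleExp_eq h.diffContOnCl_f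
    rw [h.f_zero, mul_zero] at this
    simpa [periodicCoeff] using this
  · exact periodicCoeff_of_diffContOnCl h.diffContOnCl_f hn

theorem periodicCoeff_f_one (h : IsConformalWelding γ f g) :
    periodicCoeff (fun θ => f (Circle.exp θ)) 1 = 2 * Real.pi * deriv f 0 := by
  have hd : DifferentiableOn ℂ f (Metric.ball 0 1) := h.diffContOnCl_f.differentiableOn
  have hb : Metric.ball (0 : ℂ) 1 ∈ 𝓝 0 := Metric.ball_mem_nhds 0 one_pos
  have hs : DiffContOnCl ℂ (dslope f 0) (Metric.ball 0 1) := by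
    refine ⟨(Complex.differentiableOn_dslope hb).2 hd, ?_⟩
    rw [closure_ball _ one_ne_zero]
    exact (continuousOn_dslope (Metric.closedBall_mem_nhds 0 one_pos)).2
      ⟨f.continuous.continuousOn, hd.differentiableAt hb⟩
  have := integral_circleExp_eq hs
  rw [dslope_same] at this
  rw [← this, periodicCoeff]
  refine intervalIntegral.integral_congr fun θ _ => ?_
  simp only [dslope_of_ne _ (coe_circleExp_ne_zero θ), slope_def_field, h.f_zero, sub_zero,
    zpow_neg_one, div_eq_mul_inv]

/-- On the circle `g(w) = w W(1/w)` with `W` holomorphic in the disc and `W(0) = b`, so `g` has no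
mode above `1`. -/
theorem exists_modes_g (h : IsConformalWelding γ f g) :
    ∃ b : ℂ, deriv f 0 * b = 1 ∧
      Tendsto (fun z : ℂ => g z / z) (Bornology.cobounded ℂ) (𝓝 b) ∧
      periodicCoeff (fun θ => g (Circle.exp θ)) 1 = 2 * Real.pi * b ∧
      ∀ n : ℤ, 2 ≤ n → periodicCoeff (fun θ => g (Circle.exp θ)) n = 0 := by
  obtain ⟨b, hb, hfb⟩ := h.normalized
  have hW := diffContOnCl_inversion g.continuous h.holo_g hb
  have e : (fun θ : ℝ => g (Circle.exp θ)) = fun θ : ℝ => ((Circle.exp θ : Circle) : ℂ) ^ (1 : ℤ)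
      * inversion g b (((Circle.exp θ : Circle) : ℂ)⁻¹) := by
    ext θ
    have h0 := coe_circleExp_ne_zero θ
    rw [inversion_of_ne _ _ (inv_ne_zero h0), inv_inv, zpow_one, mul_inv_cancel_left₀ h0]
  refine ⟨b, hfb, hb, ?_, fun n hn => ?_⟩
  · rw [e, periodicCoeff_zpow_mul, sub_self]
    have := periodicCoeff_inv_of_diffContOnCl hW 0
    simpa [inversion_zero] using this
  · rw [e, periodicCoeff_zpow_mul]
    exact periodicCoeff_inv_of_diffContOnCl_of_pos hW (by omega)

theorem periodicCoeff_f_mul_g (h : IsConformalWelding γ f g) :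
    periodicCoeff (fun θ => f (Circle.exp θ)) 1 * periodicCoeff (fun θ => g (Circle.exp θ)) 1
      = (2 * Real.pi) ^ 2 := by
  obtain ⟨b, hb, -, h1, -⟩ := h.exists_modes_g
  rw [h.periodicCoeff_f_one, h1]
  linear_combination (2 * Real.pi : ℂ) ^ 2 * hb

theorem hasDerivAt_f (h : IsConformalWelding γ f g) (θ : ℝ) :
    HasDerivAt (fun s : ℝ => f (Circle.exp s))
      (Complex.I * Circle.exp θ * fderiv ℝ f (Circle.exp θ) 1) θ :=
  hasDerivAt_comp_circleExp h.contDiff_f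
    (dbar_eq_zero_of_norm_le_one h.contDiff_f h.holo_f (by simp))

theorem hasDerivAt_g (h : IsConformalWelding γ f g) (θ : ℝ) :
    HasDerivAt (fun s : ℝ => g (Circle.exp s))
      (Complex.I * Circle.exp θ * fderiv ℝ g (Circle.exp θ) 1) θ :=
  hasDerivAt_comp_circleExp h.contDiff_g
    (dbar_eq_zero_of_one_le_norm h.contDiff_g h.holo_g (by simp))

theorem deriv_f_ne_zero (h : IsConformalWelding γ f g) (θ : ℝ) :
    deriv (fun s : ℝ => f (Circle.exp s)) θ ≠ 0 := by
  rw [(h.hasDerivAt_f θ).deriv]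
  exact mul_ne_zero (mul_ne_zero Complex.I_ne_zero (coe_circleExp_ne_zero θ))
    (Homeomorph.fderiv_one_ne_zero h.contDiff_f h.contDiff_f_symm
      (dbar_eq_zero_of_norm_le_one h.contDiff_f h.holo_f (by simp)))

theorem deriv_g_ne_zero (h : IsConformalWelding γ f g) (θ : ℝ) :
    deriv (fun s : ℝ => g (Circle.exp s)) θ ≠ 0 := by
  rw [(h.hasDerivAt_g θ).deriv]
  exact mul_ne_zero (mul_ne_zero Complex.I_ne_zero (coe_circleExp_ne_zero θ))
    (Homeomorph.fderiv_one_ne_zero h.contDiff_g h.contDiff_g_symm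
      (dbar_eq_zero_of_one_le_norm h.contDiff_g h.holo_g (by simp)))

/-- A vector field `u` along `f` with the Fourier modes of a holomorphic function vanishing at the
origin: `u / ∂f` extends to the disc. -/
theorem periodicCoeff_div_deriv_f (h : IsConformalWelding γ f g) {u : ℝ → ℂ} (hu : Continuous u)
    (hup : Function.Periodic u (2 * Real.pi)) (hmode : ∀ n : ℤ, n ≤ 0 → periodicCoeff u n = 0)
    {n : ℤ} (hn : n < 0) :
    periodicCoeff (fun θ => u θ / deriv (fun s : ℝ => f (Circle.exp s)) θ) n = 0 := by
  have hV := diffContOnCl_inv_fderiv h.contDiff_f h.contDiff_f_symm h.holo_f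
  set V : ℂ → ℂ := fun z => (fderiv ℝ f z 1)⁻¹
  have hVc : Continuous fun θ : ℝ => V (Circle.exp θ) :=
    hV.continuousOn_ball.comp_continuous (by fun_prop) fun θ => by simp
  -- Since `∂_θ f = i w f'(w)`, the integrand pairs `u`, with modes `≥ 1`, with `w^{-n-1}/f'`, with
  -- modes `≥ -n-1 ≥ 0`. No two modes add up to zero.
  have key := integral_mul_eq_zero_of_periodicCoeff hu
    (v := fun θ => ((Circle.exp θ : Circle) : ℂ) ^ (-n - 1) * V (Circle.exp θ))
    ((continuous_circleExp_zpow _).mul hVc) hup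
    (fun θ => by simp only [circleExp_two_pi_add]) fun m => by
      rcases le_or_gt 0 m with hm | hm
      · exact Or.inl (hmode _ (by omega))
      · right
        rw [periodicCoeff_zpow_mul]
        exact periodicCoeff_of_diffContOnCl hV (by omega)
  have e : ∀ θ, u θ / deriv (fun s : ℝ => f (Circle.exp s)) θ
      * ((Circle.exp θ : Circle) : ℂ) ^ (-n) = Complex.I⁻¹ * (u θ *
        (((Circle.exp θ : Circle) : ℂ) ^ (-n - 1) * V (Circle.exp θ))) := fun θ => by
    rw [(h.hasDerivAt_f θ).deriv, zpow_sub_one₀ (coe_circleExp_ne_zero θ), div_eq_mul_inv,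
      mul_inv, mul_inv]
    ring
  simp only [periodicCoeff, e]
  rw [intervalIntegral.integral_const_mul, key, mul_zero]

theorem periodicCoeff_div_deriv_g (h : IsConformalWelding γ f g) {u : ℝ → ℂ} (hu : Continuous u)
    (hup : Function.Periodic u (2 * Real.pi)) (hmode : ∀ n : ℤ, 2 ≤ n → periodicCoeff u n = 0)
    {n : ℤ} (hn : 0 < n) :
    periodicCoeff (fun θ => u θ / deriv (fun s : ℝ => g (Circle.exp s)) θ) n = 0 := by
  obtain ⟨b, hfb, hb, -, -⟩ := h.exists_modes_g
  obtain ⟨V, hV, hVeq⟩ := exists_diffContOnCl_inv_fderiv h.contDiff_g h.contDiff_g_symm h.holo_g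
    (right_ne_zero_of_mul_eq_one hfb) hb
  have hVc : Continuous fun θ : ℝ => V (((Circle.exp θ : Circle) : ℂ)⁻¹) :=
    hV.continuousOn_ball.comp_continuous
      (by simp_rw [← Circle.coe_inv, ← Circle.exp_neg]; fun_prop) fun θ => by simp
  -- Here `u` has modes `≤ 1` and `w^{-n-1}/g'` has modes `≤ -n-1 ≤ -2`.
  have key := integral_mul_eq_zero_of_periodicCoeff hu
    (v := fun θ => ((Circle.exp θ : Circle) : ℂ) ^ (-n - 1) * V (((Circle.exp θ : Circle) : ℂ)⁻¹))
    ((continuous_circleExp_zpow _).mul hVc) hup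
    (fun θ => by simp only [circleExp_two_pi_add]) fun m => by
      rcases le_or_gt m (-2) with hm | hm
      · exact Or.inl (hmode _ (by omega))
      · right
        rw [periodicCoeff_zpow_mul]
        exact periodicCoeff_inv_of_diffContOnCl_of_pos hV (by omega)
  have e : ∀ θ, u θ / deriv (fun s : ℝ => g (Circle.exp s)) θ
      * ((Circle.exp θ : Circle) : ℂ) ^ (-n) = Complex.I⁻¹ * (u θ *
        (((Circle.exp θ : Circle) : ℂ) ^ (-n - 1) * V (((Circle.exp θ : Circle) : ℂ)⁻¹))) :=
    fun θ => by
      rw [(h.hasDerivAt_g θ).deriv, zpow_sub_one₀ (coe_circleExp_ne_zero θ), div_eq_mul_inv,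
        mul_inv, mul_inv, hVeq _ (Circle.norm_coe _)]
      ring
  simp only [periodicCoeff, e]
  rw [intervalIntegral.integral_const_mul, key, mul_zero]

end IsConformalWelding

/-! ### Rigidity of normalized weldings -/

theorem eq_const_of_periodicCoeff {u : ℝ → ℂ} (hu : Continuous u)
    (hup : Function.Periodic u (2 * Real.pi)) (h : ∀ n : ℤ, n ≠ 0 → periodicCoeff u n = 0) :
    ∃ c : ℂ, ∀ θ, u θ = c := by
  have hconst : ∀ (c : ℂ) (n : ℤ), n ≠ 0 → periodicCoeff (fun _ => c) n = 0 := fun c n hn => by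
    have := periodicCoeff_deriv (P := fun _ => c) (p := fun _ => 0)
      (fun θ => hasDerivAt_const θ c) continuous_const (fun _ => rfl) n
    have h0 : periodicCoeff (fun _ => 0) n = 0 := by simp [periodicCoeff]
    rw [h0] at this
    simpa [hn, Complex.I_ne_zero] using this.symm
  refine ⟨periodicCoeff u 0 / (2 * Real.pi), fun θ => ?_⟩
  set c := periodicCoeff u 0 / (2 * Real.pi) with hc
  have hpi : (Real.pi : ℂ) ≠ 0 := by exact_mod_cast Real.pi_ne_zero
  have hz : (fun θ => u θ - c) = 0 := by
    refine eq_zero_of_periodicCoeff_eq_zero (hu.sub continuous_const)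
      (fun θ => by simp only [hup θ]) fun n => ?_
    have hsub : periodicCoeff (fun θ => u θ - c) n
        = periodicCoeff u n - periodicCoeff (fun _ => c) n := by
      simp only [periodicCoeff, sub_mul]
      exact intervalIntegral.integral_sub
        ((hu.mul (continuous_circleExp_zpow _)).intervalIntegrable _ _)
        ((continuous_const.mul (continuous_circleExp_zpow _)).intervalIntegrable _ _)
    rw [hsub]
    rcases eq_or_ne n 0 with rfl | hn
    · have : periodicCoeff (fun _ => c) 0 = 2 * Real.pi * c := by simp [periodicCoeff]
      rw [this, hc]
      field_simp
      ring
    · rw [h n hn, hconst c n hn, sub_zero]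
  exact sub_eq_zero.1 (congrFun hz θ)

/-- Two families of interior and exterior maps whose variations are proportional to the tangents of
the common parametrization are stationary, when they are normalized. -/
theorem variation_eq_zero {ε : ℝ} {γ : ℝ → CircleHomeoC} {f g : ℝ → (ℂ ≃ₜ ℂ)}
    (hW : ∀ t ∈ Ioo (-ε) ε, IsConformalWelding (γ t) (f t) (g t))
    (hf : IsC1Strip ε fun t θ => f t (Circle.exp θ))
    (hg : IsC1Strip ε fun t θ => g t (Circle.exp θ)) {t₀ : ℝ} (ht : t₀ ∈ Ioo (-ε) ε)
    (hω : ∀ θ : ℝ, deriv (fun t => g t (Circle.exp θ)) t₀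
        * deriv (fun s : ℝ => f t₀ (Circle.exp s)) θ
      - deriv (fun t => f t (Circle.exp θ)) t₀ * deriv (fun s : ℝ => g t₀ (Circle.exp s)) θ = 0)
    (θ : ℝ) : deriv (fun t => f t (Circle.exp θ)) t₀ = 0
      ∧ deriv (fun t => g t (Circle.exp θ)) t₀ = 0 := by
  have hfp : ∀ t, Function.Periodic (fun θ : ℝ => f t (Circle.exp θ)) (2 * Real.pi) :=
    fun t => periodic_circleExp fun w => f t w
  have hgp : ∀ t, Function.Periodic (fun θ : ℝ => g t (Circle.exp θ)) (2 * Real.pi) :=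
    fun t => periodic_circleExp fun w => g t w
  have h := hW t₀ ht
  have hcoeff : ∀ {u : ℝ → ℝ → ℂ} (_ : IsC1Strip ε u) (n : ℤ),
      HasDerivAt (fun t => periodicCoeff (u t) n)
        (periodicCoeff (fun θ => deriv (fun t => u t θ) t₀) n) t₀ := fun hu n =>
    hu.hasDerivAt_integral_mul (continuous_circleExp_zpow (-n)) ht Real.two_pi_pos.le
  have hzero : ∀ {u : ℝ → ℝ → ℂ} (_ : IsC1Strip ε u) (n : ℤ),
      (∀ t ∈ Ioo (-ε) ε, periodicCoeff (u t) n = 0) →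
        periodicCoeff (fun θ => deriv (fun t => u t θ) t₀) n = 0 := fun hu n h0 => by
    refine (hcoeff hu n).unique ((hasDerivAt_const t₀ (0 : ℂ)).congr_of_eventuallyEq ?_)
    filter_upwards [isOpen_Ioo.mem_nhds ht] with t htt using h0 t htt
  have hfd0 := h.deriv_f_ne_zero
  have hgd0 := h.deriv_g_ne_zero
  -- By `hω` the quotient is the same for `f` and `g`. The first form kills its negative modes, the
  -- second its positive ones.
  set φ : ℝ → ℂ := fun θ => deriv (fun t => f t (Circle.exp θ)) t₀
    / deriv (fun s : ℝ => f t₀ (Circle.exp s)) θ with hφ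
  have hφg : φ = fun θ => deriv (fun t => g t (Circle.exp θ)) t₀
      / deriv (fun s : ℝ => g t₀ (Circle.exp s)) θ := by
    ext θ
    rw [hφ, div_eq_div_iff (hfd0 θ) (hgd0 θ)]
    linear_combination -(hω θ)
  have hfdp := IsC1Strip.periodic_deriv_fst hfp t₀
  have hfsp := IsC1Strip.periodic_deriv_snd hfp t₀
  have hgdp := IsC1Strip.periodic_deriv_fst hgp t₀
  have hφc : Continuous φ :=
    (hf.continuous_deriv_fst ht).div (hf.continuous_deriv_snd ht) hfd0
  have hφp : Function.Periodic φ (2 * Real.pi) := fun θ => by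
    have e1 := hfdp θ
    have e2 := hfsp θ
    simp only at e1 e2
    simp only [hφ, e1, e2]
  obtain ⟨c, hc⟩ := eq_const_of_periodicCoeff hφc hφp fun n hn => by
    rcases lt_or_gt_of_ne hn with hn | hn
    · exact h.periodicCoeff_div_deriv_f (hf.continuous_deriv_fst ht) hfdp
        (fun k hk => hzero hf k fun t htt => (hW t htt).periodicCoeff_f_of_nonpos hk) hn
    · rw [hφg]
      exact h.periodicCoeff_div_deriv_g (hg.continuous_deriv_fst ht) hgdp
        (fun k hk => hzero hg k fun t htt => by
          obtain ⟨b, -, -, -, hb⟩ := (hW t htt).exists_modes_g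
          exact hb k hk) hn
  have hfc : ∀ θ : ℝ, deriv (fun t => f t (Circle.exp θ)) t₀
      = c * deriv (fun s : ℝ => f t₀ (Circle.exp s)) θ := fun θ => by
    rw [← hc θ, hφ, div_mul_cancel₀ _ (hfd0 θ)]
  have hgc : ∀ θ : ℝ, deriv (fun t => g t (Circle.exp θ)) t₀
      = c * deriv (fun s : ℝ => g t₀ (Circle.exp s)) θ := fun θ => by
    rw [← hc θ, hφg, div_mul_cancel₀ _ (hgd0 θ)]
  -- The constant `c` acts as a common infinitesimal rotation and multiplies the first mode of `f`
  -- and of `g` by `ic`. Their product is constant by normalization, so `2ic (2π)² = 0`.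
  have hc0 : c = 0 := by
    have hmode : ∀ {u : ℝ → ℝ → ℂ} (_ : IsC1Strip ε u)
        (_ : ∀ t, Function.Periodic (u t) (2 * Real.pi)),
        (∀ θ, deriv (fun t => u t θ) t₀ = c * deriv (u t₀) θ) →
        periodicCoeff (fun θ => deriv (fun t => u t θ) t₀) 1
          = c * (Complex.I * periodicCoeff (u t₀) 1) := fun {u} hu hup hd => by
      have h1 := periodicCoeff_deriv (fun θ => hu.hasDerivAt_snd ht θ)
        (hu.continuous_deriv_snd ht) (hup t₀) 1
      rw [Int.cast_one, mul_one] at h1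
      rw [← h1]
      simp only [periodicCoeff, hd, mul_assoc]
      rw [intervalIntegral.integral_const_mul]
    have hprod := (hcoeff hf 1).mul (hcoeff hg 1)
    have hconst : HasDerivAt (fun t => periodicCoeff (fun θ => f t (Circle.exp θ)) 1
        * periodicCoeff (fun θ => g t (Circle.exp θ)) 1) 0 t₀ := by
      refine (hasDerivAt_const t₀ ((2 * Real.pi : ℂ) ^ 2)).congr_of_eventuallyEq ?_
      filter_upwards [isOpen_Ioo.mem_nhds ht] with t htt
      exact (hW t htt).periodicCoeff_f_mul_g
    have h2 := hprod.unique hconst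
    rw [hmode hf hfp hfc, hmode hg hgp hgc] at h2
    have h3 := h.periodicCoeff_f_mul_g
    have h4 : c * (2 * Complex.I * (2 * Real.pi) ^ 2) = 0 := by
      rw [← h3, ← h2]; ring
    refine (mul_eq_zero.1 h4).resolve_right ?_
    simp [Complex.I_ne_zero, Real.pi_ne_zero]
  rw [hfc, hgc, hc0, zero_mul, zero_mul]
  exact ⟨rfl, rfl⟩

theorem hasDerivAt_zero_of_variation {ε : ℝ} {γ : ℝ → CircleHomeoC} {f g : ℝ → (ℂ ≃ₜ ℂ)}
    (hγ : IsC1Strip ε fun t θ => ((γ t).toHomeo (Circle.exp θ) : ℂ))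
    (hW : ∀ t ∈ Ioo (-ε) ε, IsConformalWelding (γ t) (f t) (g t))
    (hf : IsC1Strip ε fun t θ => f t (Circle.exp θ))
    (hg : IsC1Strip ε fun t θ => g t (Circle.exp θ)) {t₀ : ℝ} (ht : t₀ ∈ Ioo (-ε) ε)
    (hf0 : ∀ θ : ℝ, deriv (fun t => f t (Circle.exp θ)) t₀ = 0)
    (hg0 : ∀ θ : ℝ, deriv (fun t => g t (Circle.exp θ)) t₀ = 0) (w : Circle) :
    HasDerivAt (fun t => ((γ t).toHomeo w : ℂ)) 0 t₀ := by
  obtain ⟨θ, rfl⟩ := Circle.exp_surjective w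
  obtain ⟨a₀, ha₀⟩ := Circle.exp_surjective ((γ t₀).toHomeo (Circle.exp θ))
  -- Dividing by the value at `t₀` gives `q t₀ = 1`, away from the branch cut, so the angle `α` is
  -- differentiable at `t₀`.
  let q : ℝ → Circle := fun t => (γ t).toHomeo (Circle.exp θ) / (γ t₀).toHomeo (Circle.exp θ)
  let α : ℝ → ℝ := fun t => Complex.arg (q t) + a₀
  have hα0 : α t₀ = a₀ := by simp [α, q]
  have hαexp : ∀ t, Circle.exp (α t) = (γ t).toHomeo (Circle.exp θ) := fun t => by
    simp only [α, Circle.exp_add, Circle.exp_arg, ha₀, q, div_mul_cancel]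
  obtain ⟨a', ha'⟩ : ∃ a' : ℝ, HasDerivAt α a' t₀ := by
    have h1 : HasDerivAt (fun t => (q t : ℂ))
        (deriv (fun t => ((γ t).toHomeo (Circle.exp θ) : ℂ)) t₀
          / ((γ t₀).toHomeo (Circle.exp θ) : ℂ)) t₀ := by
      simp only [q, Circle.coe_div]
      exact (hγ.hasDerivAt_fst ht θ).div_const _
    have h2 := h1.clog_real (by simp [q])
    have h3 := (Complex.imCLM.hasFDerivAt.comp_hasDerivAt t₀ h2).add_const a₀
    refine ⟨_, h3.congr_of_eventuallyEq (Eventually.of_forall fun t => ?_)⟩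
    simp [α, Complex.log_im]
  have hG := hg.differentiableAt ht a₀
  have hcomp := (hα0.symm ▸ hG : DifferentiableAt ℝ
    (fun p : ℝ × ℝ => g p.1 (Circle.exp p.2)) (t₀, α t₀)).hasFDerivAt.comp_hasDerivAt t₀
    ((hasDerivAt_id t₀).prodMk ha')
  have hfder : HasDerivAt (fun t => f t (Circle.exp θ)) 0 t₀ := hf0 θ ▸ hf.hasDerivAt_fst ht θ
  have hcong : (fun p : ℝ × ℝ => g p.1 (Circle.exp p.2)) ∘ (fun t => (id t, α t))
      =ᶠ[𝓝 t₀] fun t => f t (Circle.exp θ) := by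
    filter_upwards [isOpen_Ioo.mem_nhds ht] with t htt
    simp only [Function.comp, id, hαexp]
    exact ((hW t htt).apply_eq _).symm
  -- The derivative of `g_t(e^{iα(t)}) = f_t(e^{iθ})` at `t₀`. As `ḟ = ġ = 0`, it leaves `α' ∂_θ g =
  -- 0` with `∂_θ g ≠ 0`.
  have hz := hcomp.unique (hfder.congr_of_eventuallyEq hcong)
  have hsplit : ((1 : ℝ), a') = (1, 0) + a' • ((0 : ℝ), (1 : ℝ)) := by simp
  rw [hα0, hsplit, map_add, map_smul, ← (hg.hasDerivAt_fst' ht a₀).deriv,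
    ← (hg.hasDerivAt_snd' ht a₀).deriv, hg0, zero_add] at hz
  have ha0 : a' = 0 := (smul_eq_zero.1 hz).resolve_right ((hW t₀ ht).deriv_g_ne_zero a₀)
  have := HasDerivAt.scomp t₀ (hasDerivAt_coe_circleExp (α t₀)) ha'
  rw [ha0, zero_smul] at this
  refine this.congr_of_eventuallyEq (Eventually.of_forall fun t => ?_)
  simp only [Function.comp, hαexp]

/-! ### Completeness of the welding variables -/

theorem weldingTime_of_pos (f g : ℂ → ℂ) {n : ℤ} (hn : 0 < n) :
    weldingTime f g n = (1 / (2 * Real.pi * Complex.I * n)) *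
      ∫ θ in (0 : ℝ)..(2 * Real.pi), g (Circle.exp θ) ^ (-n) * f (Circle.exp θ) ^ (-1 : ℤ)
        * deriv (fun s : ℝ => g (Circle.exp s)) θ := by
  rw [weldingTime, if_pos hn, circleIntegralD]
  simp only [zpow_neg_one, div_eq_mul_inv]

theorem weldingTime_zero (f g : ℂ → ℂ) :
    weldingTime f g 0 = (1 / (2 * Real.pi * Complex.I)) *
      ∫ θ in (0 : ℝ)..(2 * Real.pi), g (Circle.exp θ) ^ (0 : ℤ) * f (Circle.exp θ) ^ (-1 : ℤ)
        * deriv (fun s : ℝ => g (Circle.exp s)) θ := by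
  rw [weldingTime, if_neg (lt_irrefl _), if_pos rfl, circleIntegralD]
  simp only [zpow_neg_one, zpow_zero, one_mul, one_div]

theorem weldingTime_of_neg (f g : ℂ → ℂ) {n : ℤ} (hn : n < 0) :
    weldingTime f g n = (1 / (2 * Real.pi * Complex.I * n)) *
      ∫ θ in (0 : ℝ)..(2 * Real.pi), f (Circle.exp θ) ^ (-n - 2) * g (Circle.exp θ) ^ (1 : ℤ)
        * deriv (fun s : ℝ => f (Circle.exp s)) θ := by
  rw [weldingTime, if_neg hn.not_gt, if_neg hn.ne, circleIntegralD]
  simp only [zpow_one, mul_comm]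

theorem deriv_param_eq_zero_of_weldingTime {ε : ℝ} {γ : ℝ → CircleHomeoC} {f g : ℝ → (ℂ ≃ₜ ℂ)}
    (hγ : IsC1Strip ε fun t θ => ((γ t).toHomeo (Circle.exp θ) : ℂ))
    (hW : ∀ t ∈ Ioo (-ε) ε, IsConformalWelding (γ t) (f t) (g t))
    (hf : IsC1Strip ε fun t θ => f t (Circle.exp θ))
    (hg : IsC1Strip ε fun t θ => g t (Circle.exp θ)) {t₀ : ℝ} (ht : t₀ ∈ Ioo (-ε) ε)
    (h : ∀ n : ℤ, HasDerivAt (fun t => weldingTime (f t) (g t) n) 0 t₀) (w : Circle) :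
    HasDerivAt (fun t => ((γ t).toHomeo w : ℂ)) 0 t₀ := by
  have hpi : (Real.pi : ℂ) ≠ 0 := by exact_mod_cast Real.pi_ne_zero
  have hfp : ∀ t, Function.Periodic (fun θ : ℝ => f t (Circle.exp θ)) (2 * Real.pi) :=
    fun t => periodic_circleExp fun w => f t w
  have hgp : ∀ t, Function.Periodic (fun θ : ℝ => g t (Circle.exp θ)) (2 * Real.pi) :=
    fun t => periodic_circleExp fun w => g t w
  have hf0 : ∀ t ∈ Ioo (-ε) ε, ∀ θ : ℝ, f t (Circle.exp θ) ≠ 0 := fun t htt θ =>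
    (hW t htt).f_ne_zero _
  have hg0 : ∀ t ∈ Ioo (-ε) ε, ∀ θ : ℝ, g t (Circle.exp θ) ≠ 0 := fun t htt θ =>
    (hW t htt).g_ne_zero _
  let ω : ℝ → ℂ := fun θ => deriv (fun t => g t (Circle.exp θ)) t₀
        * deriv (fun s : ℝ => f t₀ (Circle.exp s)) θ
      - deriv (fun t => f t (Circle.exp θ)) t₀ * deriv (fun s : ℝ => g t₀ (Circle.exp s)) θ
  -- The factor `f⁻²` makes both families of variations moments of one density: `∫ κ g^{-n}` from
  -- `g^{-n} f⁻¹ dg`, and `∫ κ f^n` from `g f^{n-2} df`.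
  let κ : ℝ → ℂ := fun θ => f t₀ (Circle.exp θ) ^ (-2 : ℤ) * ω θ
  have hωc : Continuous ω :=
    ((hg.continuous_deriv_fst ht).mul (hf.continuous_deriv_snd ht)).sub
      ((hf.continuous_deriv_fst ht).mul (hg.continuous_deriv_snd ht))
  have hκc : Continuous κ :=
    ((hf.continuous_snd ht).zpow₀ _ fun θ => Or.inl (hf0 t₀ ht θ)).mul hωc
  have hκp : Function.Periodic κ (2 * Real.pi) := fun θ => by
    have e1 := IsC1Strip.periodic_deriv_fst hfp t₀ θ
    have e2 := IsC1Strip.periodic_deriv_snd hfp t₀ θ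
    have e3 := IsC1Strip.periodic_deriv_fst hgp t₀ θ
    have e4 := IsC1Strip.periodic_deriv_snd hgp t₀ θ
    have e5 := hfp t₀ θ
    simp only at e1 e2 e3 e4 e5
    simp only [κ, ω, e1, e2, e3, e4, e5]
  have hG : ∀ n : ℕ, ∫ θ in (0 : ℝ)..(2 * Real.pi),
      κ θ * (g t₀ (Circle.exp θ))⁻¹ ^ n = 0 := by
    intro n
    have hd := hg.hasDerivAt_integral_zpow_mul_zpow hf Real.two_pi_pos.le hgp hfp hg0 hf0 ht
      (-n) (-1)
    have hn : HasDerivAt (fun t => ∫ θ in (0 : ℝ)..(2 * Real.pi), g t (Circle.exp θ) ^ (-n : ℤ)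
        * f t (Circle.exp θ) ^ (-1 : ℤ) * deriv (fun s : ℝ => g t (Circle.exp s)) θ) 0 t₀ := by
      rcases n.eq_zero_or_pos with rfl | hn
      · have h1 := (h 0).const_mul (2 * Real.pi * Complex.I)
        simp only [weldingTime_zero, mul_zero] at h1
        refine h1.congr_of_eventuallyEq (Eventually.of_forall fun t => ?_)
        simp only [Nat.cast_zero, neg_zero]
        field_simp [Complex.I_ne_zero]
      · have hn' : (n : ℂ) ≠ 0 := by exact_mod_cast hn.ne'
        have hp : (0 : ℤ) < n := by exact_mod_cast hn
        have h1 := (h n).const_mul (2 * Real.pi * Complex.I * n)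
        simp only [weldingTime_of_pos _ _ hp, mul_zero, Int.cast_natCast] at h1
        refine h1.congr_of_eventuallyEq (Eventually.of_forall fun t => ?_)
        simp only
        field_simp [Complex.I_ne_zero]
    have hz := hd.unique hn
    rw [← hz]
    refine intervalIntegral.integral_congr fun θ _ => ?_
    simp only [κ, ω, inv_pow, zpow_neg, zpow_natCast]
    push_cast
    norm_num
    ring
  have hF : ∀ n : ℕ, ∫ θ in (0 : ℝ)..(2 * Real.pi), κ θ * f t₀ (Circle.exp θ) ^ n = 0 := by
    intro n
    rcases n.eq_zero_or_pos with rfl | hn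
    -- The zeroth moment is common to both families and comes from `t_0`.
    · simpa using hG 0
    · have hd := hf.hasDerivAt_integral_zpow_mul_zpow hg Real.two_pi_pos.le hfp hgp hf0 hg0 ht
        (n - 2) 1
      have hn' : (n : ℂ) ≠ 0 := by exact_mod_cast hn.ne'
      have hp : (-n : ℤ) < 0 := by omega
      have h1 := (h (-n)).const_mul (2 * Real.pi * Complex.I * (-n))
      simp only [weldingTime_of_neg _ _ hp, mul_zero, neg_neg, Int.cast_neg,
        Int.cast_natCast] at h1
      have h2 : HasDerivAt (fun t => ∫ θ in (0 : ℝ)..(2 * Real.pi),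
          f t (Circle.exp θ) ^ (n - 2 : ℤ) * g t (Circle.exp θ) ^ (1 : ℤ)
            * deriv (fun s : ℝ => f t (Circle.exp s)) θ) 0 t₀ := by
        refine h1.congr_of_eventuallyEq (Eventually.of_forall fun t => ?_)
        simp only
        field_simp [Complex.I_ne_zero]
      have hz := hd.unique h2
      rw [← hz]
      refine intervalIntegral.integral_congr fun θ _ => ?_
      simp only [κ, ω, sub_self, zpow_zero, Int.cast_one, sub_eq_add_neg (n : ℤ) 2,
        zpow_add₀ (hf0 t₀ ht θ), zpow_natCast]
      ring
  have hwt := hW t₀ ht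
  have hκ0 := eq_zero_of_moments hwt.contDiff_f_symm hwt.contDiff_g_symm hwt.holo_f hwt.holo_g
    hwt.norm_g_symm_zero hκc hκp hF fun n => hG (n + 1)
  have hω0 : ∀ θ, ω θ = 0 := fun θ =>
    (mul_eq_zero.1 (congrFun hκ0 θ)).resolve_left (zpow_ne_zero _ (hf0 t₀ ht θ))
  have hv := variation_eq_zero hW hf hg ht hω0
  exact hasDerivAt_zero_of_variation hγ hW hf hg ht (fun θ => (hv θ).1) (fun θ => (hv θ).2) w

theorem mainTheorem9 (ε : ℝ) (hε : 0 < ε) (γ : ℝ → CircleHomeoC)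
    (hγ : IsC1Family ε (fun t w => ((γ t).toHomeo w : ℂ))) :
    -- the variables given by Fourier coefficients
    ((∀ t₀ ∈ Set.Ioo (-ε) ε,
        (∀ n : ℤ, HasDerivAt (fun t => fourierTime (γ t) n) 0 t₀) →
          ∀ w : Circle, HasDerivAt (fun t => ((γ t).toHomeo w : ℂ)) 0 t₀) ∧
      ((∀ t₀ ∈ Set.Ioo (-ε) ε, ∀ n : ℤ, HasDerivAt (fun t => fourierTime (γ t) n) 0 t₀) →
        ∀ t ∈ Set.Ioo (-ε) ε, γ t = γ 0)) ∧
    -- the variables given by contour integrals of the conformal maps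
    (∀ f g : ℝ → (ℂ ≃ₜ ℂ),
      (∀ t ∈ Set.Ioo (-ε) ε, IsConformalWelding (γ t) (f t) (g t)) →
      IsC1Family ε (fun t w => f t w) → IsC1Family ε (fun t w => g t w) →
      (∀ t₀ ∈ Set.Ioo (-ε) ε,
        (∀ n : ℤ, HasDerivAt (fun t => weldingTime (f t) (g t) n) 0 t₀) →
          ∀ w : Circle, HasDerivAt (fun t => ((γ t).toHomeo w : ℂ)) 0 t₀) ∧
      ((∀ t₀ ∈ Set.Ioo (-ε) ε, ∀ n : ℤ,
          HasDerivAt (fun t => weldingTime (f t) (g t) n) 0 t₀) →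
        ∀ t ∈ Set.Ioo (-ε) ε, γ t = γ 0)) := by
  refine ⟨⟨fun t₀ ht h => deriv_param_eq_zero_of_fourierTime hγ ht h, fun h t ht =>
    eq_of_hasDerivAt_zero hε
      (fun s hs => deriv_param_eq_zero_of_fourierTime hγ hs (h s hs)) ht⟩, ?_⟩
  intro f g hW hf hg
  exact ⟨fun t₀ ht h => deriv_param_eq_zero_of_weldingTime hγ hW hf hg ht h, fun h t ht =>
    eq_of_hasDerivAt_zero hε
      (fun s hs => deriv_param_eq_zero_of_weldingTime hγ hW hf hg hs (h s hs)) ht⟩
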